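/- **Setting.** Let $K$ be a field and let $(\hat V,\sigma,m,\mathbf 1)$ be a unital braided algebra: $(\hat V,m,\mathbf 1)$ is a unital associative $K$-algebra and $\sigma\in\operatorname{End}(\hat V^{\otimes 2})$ satisfies, with $\sigma_1=\sigma\otimes\mathrm{id}$ and $\sigma_2=\mathrm{id}\otimes\sigma$, the identities $\sigma_1\sigma_2\sigma_1=\sigma_2\sigma_1\sigma_2$, $\sigma(m\otimes\mathrm{id})=(\mathrm{id}\otimes m)\sigma_1\sigma_2$, $\sigma(\mathrm{id}\otimes m)=(m\otimes\mathrm{id})\sigma_2\sigma_1$, and $\sigma(\mathbf 1\otimes v)=v\otimes\mathbf 1$, $\sigma(v\otimes\mathbf 1)=\mathbf 1\otimes v$ for all $v\in\hat V$. Let $\sigma^m(v\otimes w)=\mathbf 1\otimes m(v\otimes w)$. For $n\ge 1$ let $\mathrm{GVB}_n^+$ be the monoid with generators $\sigma_i,\xi_i$ $(1\le i\le n-1)$ and relations: $\sigma_i\sigma_j=\sigma_j\sigma_i$, $\sigma_i\xi_j=\xi_j\sigma_i$, $\xi_i\xi_j=\xi_j\xi_i$ for $|i-j|>1$; and, for $1\le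 i\le n-2$, $\sigma_i\sigma_{i+1}\sigma_i=\sigma_{i+1}\sigma_i\sigma_{i+1}$, $\xi_i\xi_{i+1}\xi_i=\xi_{i+1}\xi_i\xi_{i+1}$, $\xi_i\sigma_{i+1}\sigma_i=\sigma_{i+1}\sigma_i\xi_{i+1}$, $\xi_{i+1}\sigma_i\sigma_{i+1}=\sigma_i\sigma_{i+1}\xi_i$. The algebra $K[\mathrm{GVB}_n^+]$ acts on $\hat V^{\otimes n}$, with $\sigma_i$ acting as $\sigma$ and $\xi_i$ as $\sigma^m$ on the tensor factors $i,i+1$. Let $l_v(\tau)$ be the number of letters $\xi_i$ in an expression of $\tau\in\mathrm{GVB}_n^+$ (it does not depend on the expression). **Permutations.** For $s\in\mathfrak S_n$ let $s(a)$ be the position to which $s$ moves the letter at position $a$; products are compositions. Let $\mathfrak S_{p,q}^{\uparrow r}\subset\mathfrak S_n$ be the set of $s$ which fix every position outside $\{r+1,\dots,r+p+q\}$ and are increasing on $\{r+1,\dots,r+p\}$ and on $\{r+p+1,\dots,r+p+q\}$. For $I\subset\{1,\dots,n-1\}$ let $\mathrm{des}_n(\le I)$ be the set of $s\in\mathfrak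 S_n$ such that $s(i)>s(i+1)$ implies $i\in I$, and let $D_{\le I}=\sum_{s\in\mathrm{des}_n(\le I)}s\in K[\mathfrak S_n]$. **Lifting of shuffles.** For $1\le k\le n-1$ put $t_k(s)=1+\#\{a\le k: s(a)<s(k+1)\}$ if this is at most $k$, and $t_k(s)=0$ otherwise; put $t_n(s)=0$. (The nontrivial factors of the bubble decomposition of $s$ are $s_{t_k}s_{t_k+1}\cdots s_k$, for $t_k\ne 0$.) For $d\ge 0$ and a shuffle $s$ that fixes the last $d$ positions, let, with $t_k=t_k(s)$, $$Q^{\to d}(s)=\prod_{k=n-1,\dots,1;\ t_k\ne 0}\bigl(\sigma_{t_k+d}+(1-\delta_{t_k+1,t_{k+1}})\,\sigma_1\cdots\sigma_{t_k+d-1}\,\xi_{t_k+d}\bigr)\,\sigma_{t_k+d+1}\cdots\sigma_{k+d}\in K[\mathrm{GVB}_n^+],$$ the factors being taken in descending order of $k$. For $r,p,q$ with $p,q\geq 1$, $r+p+q\le n$ and $s\in\mathfrak S_{p,q}^{\uparrow r}$ let $\mathbf M^{r}_{p,q}(s;x,y)$ be the expression, bilinear in $x,y\in K[\mathrm{GVB}_n^+]$,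 that for $x=a$ and $y=b$ in $\mathrm{GVB}_n^+$ with $l=l_v(a)$, $l'=l_v(b)$ equals $Q^{\to l'}(s)\,b\,a$ if $l<p$, $l'<q$ and $s\in\mathfrak S_{p-l,q-l'}^{\uparrow(r+l)}$, and equals $0$ otherwise. **Decompositions into $k$ shuffles.** Let $I\subset\{1,\dots,n-1\}$ have $k$ elements, and let $(c_1,\dots,c_{k+1})$ be the composition of $n$ with $I=\{c_1,c_1+c_2,\dots,c_1+\cdots+c_k\}$. Cut $\{1,\dots,n\}$ into consecutive blocks of lengths $c_1,\dots,c_{k+1}$. Every complete bracketing $T$ of the $k+1$ blocks has $k$ inner nodes; a node that joins a left part of length $p$ and a right part of length $q$, starting at position $r+1$, is assigned the set $\mathfrak S_{p,q}^{\uparrow r}$. Every $s\in\mathrm{des}_n(\le I)$ is in exactly one way a product of elements of these $k$ sets, multiplied recursively: the product of a node is (element of the node)·(product of the right part)·(product of the left part). The lifting $Q_{I,T}(s)\in K[\mathrm{GVB}_n^+]$ is obtained by the same recursion from these elements: the lifting of a block is $1$, and the lifting of a node with element $u\in\mathfrak S_{p,q}^{\uparrow r}$ is $\mathbf M^{r}_{p,q}(u;x,y)$,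 where $x$ and $y$ are the liftings of its left and its right part. Extend $Q_{I,T}$ linearly to the span of $\mathrm{des}_n(\le I)$. (The bracketing from the left gives the decomposition into $\mathfrak S_{c_1+\cdots+c_k,c_{k+1}}\times\cdots\times\mathfrak S_{c_1,c_2}$, the one from the right that into $\mathfrak S_{c_1,c_2+\cdots+c_{k+1}}\times\cdots\times\mathfrak S_{c_k,c_{k+1}}^{\uparrow c_1+\cdots+c_{k-1}}$.) **Corollary.** Let $Q_I=Q_{I,T}$ and $Q_I'=Q_{I,T'}$ be the liftings of $\mathrm{des}_n(\le I)$ according to two decompositions of $\mathrm{des}_n(\le I)$ into $k$ shuffles, given by bracketings $T$ and $T'$. Then the images of $Q_I(D_{\le I})$ and $Q_I'(D_{\le I})$ in $\operatorname{End}(\hat V^{\otimes n})$ coincide. -/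

import Mathlib

open scoped TensorProduct

namespace QuasiShuffle

/-! ### The generalized virtual braid monoid -/

/-- The generators `σ_i`, `ξ_i` (`1 ≤ i ≤ n - 1`) of the generalized virtual braid monoid. -/
inductive GVBGen (n : ℕ) : Type
  | braid (i : {i : ℕ // 1 ≤ i ∧ i < n}) : GVBGen n
  | virt (i : {i : ℕ // 1 ≤ i ∧ i < n}) : GVBGen n

open GVBGen FreeMonoid in
/-- The defining relations of the generalized virtual braid monoid. -/
inductive GVBRel (n : ℕ) : FreeMonoid (GVBGen n) → FreeMonoid (GVBGen n) → Prop
  | comm_braid_braid (i j) (h : i.1 + 1 < j.1 ∨ j.1 + 1 < i.1) :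
      GVBRel n (of (braid i) * of (braid j)) (of (braid j) * of (braid i))
  | comm_braid_virt (i j) (h : i.1 + 1 < j.1 ∨ j.1 + 1 < i.1) :
      GVBRel n (of (braid i) * of (virt j)) (of (virt j) * of (braid i))
  | comm_virt_virt (i j) (h : i.1 + 1 < j.1 ∨ j.1 + 1 < i.1) :
      GVBRel n (of (virt i) * of (virt j)) (of (virt j) * of (virt i))
  | braid_braid (i j) (h : j.1 = i.1 + 1) :
      GVBRel n (of (braid i) * of (braid j) * of (braid i))
        (of (braid j) * of (braid i) * of (braid j))
  | virt_virt (i j) (h : j.1 = i.1 + 1) :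
      GVBRel n (of (virt i) * of (virt j) * of (virt i))
        (of (virt j) * of (virt i) * of (virt j))
  | mixed_left (i j) (h : j.1 = i.1 + 1) :
      GVBRel n (of (virt i) * of (braid j) * of (braid i))
        (of (braid j) * of (braid i) * of (virt j))
  | mixed_right (i j) (h : j.1 = i.1 + 1) :
      GVBRel n (of (virt j) * of (braid i) * of (braid j))
        (of (braid i) * of (braid j) * of (virt i))

/-- The generalized virtual braid monoid `GVB_n⁺`. -/
abbrev GVB (n : ℕ) : Type := PresentedMonoid (GVBRel n)

/-- The element `σ_i` of `GVB_n⁺`; it is only used for `1 ≤ i ≤ n - 1`. -/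
def sig (n i : ℕ) : GVB n :=
  if h : 1 ≤ i ∧ i < n then PresentedMonoid.of _ (GVBGen.braid ⟨i, h⟩) else 1

/-- The element `ξ_i` of `GVB_n⁺`; it is only used for `1 ≤ i ≤ n - 1`. -/
def xi (n i : ℕ) : GVB n :=
  if h : 1 ≤ i ∧ i < n then PresentedMonoid.of _ (GVBGen.virt ⟨i, h⟩) else 1

/-- The virtual length of a generator. -/
def GVBGen.virtualLength {n : ℕ} : GVBGen n → Multiplicative ℕ
  | braid _ => Multiplicative.ofAdd 0
  | virt _ => Multiplicative.ofAdd 1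

/-- The number of letters `ξ_i` in any expression, as a monoid homomorphism. -/
def virtualLengthHom (n : ℕ) : GVB n →* Multiplicative ℕ :=
  PresentedMonoid.lift GVBGen.virtualLength (by
    intro a b h
    cases h <;> simp [GVBGen.virtualLength, mul_comm])

/-- The virtual length `l_v(τ)`: the number of letters `ξ_i` in any expression of `τ`. -/
def virtualLength {n : ℕ} (τ : GVB n) : ℕ := (virtualLengthHom n τ).toAdd

/-! ### Permutations, shuffles and descents

A permutation acts on tensors by permuting positions: `σ a` is the position to which `σ` moves the
letter that stands at position `a`, so that the product is composition. (The word whose `b`-th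
letter is `σ⁻¹ b` is the result of applying `σ` to `0 1 ⋯ (n-1)`.) Elements of `Fin n` start at
`0`, so the position `i ∈ {1, …, n}` is the element `i - 1` of `Fin n`. -/

/-- Membership in `𝔖_{p,q}^{↑r}`, as a subset of `𝔖_n`: `σ` fixes everything outside the block of
the positions `r + 1, …, r + p + q`, and keeps the order of the first `p` and of the last `q`
letters of this block. -/
def IsShuffle {n : ℕ} (r p q : ℕ) (σ : Equiv.Perm (Fin n)) : Prop :=
  (∀ a : Fin n, a.1 < r ∨ r + p + q ≤ a.1 → σ a = a) ∧
  (∀ a b : Fin n, r ≤ a.1 → a < b → b.1 < r + p → σ a < σ b) ∧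
  (∀ a b : Fin n, r + p ≤ a.1 → a < b → b.1 < r + p + q → σ a < σ b)

/-- `i ∈ {1, …, n - 1}` is a descent of `σ` if the `i`-th letter is moved to a place behind that
of the `(i+1)`-st one. -/
def IsDescent {n : ℕ} (σ : Equiv.Perm (Fin n)) (i : ℕ) : Prop :=
  ∃ a b : Fin n, a.1 + 1 = i ∧ b.1 = i ∧ σ b < σ a

open Classical in
/-- `des_n(≤ I)`: the permutations all of whose descents lie in `I`. -/
noncomputable def desLE (n : ℕ) (I : Finset ℕ) : Finset (Equiv.Perm (Fin n)) :=
  Finset.univ.filter fun σ => ∀ i, IsDescent σ i → i ∈ I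

/-- The number of letters among the first `k` ones that `σ` leaves in front of the `(k+1)`-st. -/
def rankAt {n : ℕ} (σ : Equiv.Perm (Fin n)) (k : Fin n) : ℕ :=
  (Finset.univ.filter fun a : Fin n => a < k ∧ σ a < σ k).card

/-- The number `t_k(σ)` of the bubble decomposition `σ = σ^(n-1) ⋯ σ^(1)`: if `σ^(k) ≠ e` then
`σ^(k) = s_t s_{t+1} ⋯ s_k` with `t = t_k(σ)`, and otherwise `t_k(σ) = 0`. The factor `σ^(k)` moves
the `(k+1)`-st letter into its place among the first `k` letters, that is to the position one more
than the number of these letters in front of it. For `k ≥ n` the value is `0`. -/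
def bubble {n : ℕ} (σ : Equiv.Perm (Fin n)) (k : ℕ) : ℕ :=
  if h : k < n then
    if rankAt σ ⟨k, h⟩ < k then rankAt σ ⟨k, h⟩ + 1 else 0
  else 0

/-! ### Liftings -/

section Lifting

variable (K : Type*) [Field K]

/-- The product `σ_a σ_{a+1} ⋯ σ_{a+l-1}` of `l` consecutive generators. -/
def sigRun (n a l : ℕ) : GVB n := ((List.range' a l).map (sig n)).prod

open Classical in
/-- The factor of the generalized Matsumoto-Tits lifting which belongs to `σ^(k) ≠ e`, with all
positions shifted by `d`: with `t = t_k(σ)` it is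
`(σ_{t+d} + (1 - δ_{t+1, t_{k+1}(σ)}) σ_1 ⋯ σ_{t+d-1} ξ_{t+d}) σ_{t+d+1} ⋯ σ_{k+d}`. -/
noncomputable def liftFactor {n : ℕ} (d : ℕ) (σ : Equiv.Perm (Fin n)) (k : ℕ) :
    MonoidAlgebra K (GVB n) :=
  (MonoidAlgebra.of K (GVB n) (sig n (bubble σ k + d)) +
    (if bubble σ k + 1 = bubble σ (k + 1) then 0 else
      MonoidAlgebra.of K (GVB n) (sigRun n 1 (bubble σ k + d - 1) * xi n (bubble σ k + d)))) *
    MonoidAlgebra.of K (GVB n) (sigRun n (bubble σ k + d + 1) (k - bubble σ k))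

/-- The generalized Matsumoto-Tits lifting `Q^{→d}(σ) ∈ K[GVB_n⁺]` of a shuffle `σ`, applied to the
positions moved to the right by `d`: the product of the above factors over all `k` such that
`σ^(k) ≠ e`, in descending order. For `d = 0` this is `Q_{p,q}(σ)`. -/
noncomputable def shuffleLift {n : ℕ} (d : ℕ) (σ : Equiv.Perm (Fin n)) :
    MonoidAlgebra K (GVB n) :=
  (((List.range' 1 (n - 1)).reverse).map fun k =>
    if bubble σ k = 0 then 1 else liftFactor K d σ k).prod

open Classical in
/-- The operation combining liftings. Let a block of positions `r + 1, …, r + p + q` be cut into a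
left part of length `p` and a right part of length `q`, let `x` and `y` be liftings of permutations
of the left and of the right part and let `σ ∈ 𝔖_{p,q}^{↑r}`. The result is bilinear in `x` and
`y`; for `x = a` and `y = b` in `GVB_n⁺` of virtual lengths `l` and `m` it is
`Q_{p-l,q-m}^{→m}(σ) b a` if `l < p`, `m < q` and `σ ∈ 𝔖_{p-l,q-m}^{↑(r+l)}`, and `0` otherwise.
(Every `ξ` of a lifting moves one unit `1` to the very left, so that after applying `b a` the two
parts have lengths `p - l` and `q - m` and the block starts behind position `r + l + m`.)
With `r = 0` and `y = 1` this is `M_{p,q}(σ, x)`; with `x = 1` it is the analogue `M'_{p,q}` for a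
product bracketed on the right. -/
noncomputable def combine {n : ℕ} (r p q : ℕ) (σ : Equiv.Perm (Fin n))
    (x y : MonoidAlgebra K (GVB n)) : MonoidAlgebra K (GVB n) :=
  x.coeff.sum fun a s => y.coeff.sum fun b t => (s * t) •
    (if virtualLength a < p ∧ virtualLength b < q ∧
        IsShuffle (r + virtualLength a) (p - virtualLength a) (q - virtualLength b) σ then
      shuffleLift K (virtualLength b) σ * MonoidAlgebra.of K (GVB n) (b * a)
    else 0)

end Lifting

/-- A bracketing of a product of consecutive blocks, of given positive lengths. It records a way to
decompose permutations into shuffles, one for every inner node: `((1 2) 3) ⋯` gives the shuffles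
`𝔖_{c_1,c_2}`, `𝔖_{c_1+c_2,c_3}`, …, and `⋯ (k (k+1))` gives `𝔖_{c_k,c_{k+1}}^{↑(c_1+⋯+c_{k-1})}`,
`𝔖_{c_{k-1},c_k+c_{k+1}}^{↑(c_1+⋯+c_{k-2})}`, …. -/
inductive Bracketing : Type
  | leaf (c : ℕ+) : Bracketing
  | node (L R : Bracketing) : Bracketing

namespace Bracketing

/-- The total number of letters. -/
def size : Bracketing → ℕ
  | leaf c => c
  | node L R => L.size + R.size

/-- The positions `i` such that, if the first letter has the number `r + 1`, one block ends with
letter `i` and another one starts with letter `i + 1`. For the blocks of lengths `c_1, …, c_{k+1}`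
and `r = 0` these are `c_1, c_1 + c_2, …, c_1 + ⋯ + c_k`. -/
def cuts : Bracketing → ℕ → Finset ℕ
  | leaf _, _ => ∅
  | node L R, r => L.cuts r ∪ {r + L.size} ∪ R.cuts (r + L.size)

/-- A choice of a permutation of `n` letters at every inner node of a bracketing. -/
def Labels (n : ℕ) : Bracketing → Type
  | leaf _ => Unit
  | node L R => Equiv.Perm (Fin n) × Labels n L × Labels n R

/-- Each label is a shuffle of the two parts of its node, the first letter being number `r + 1`. -/
def AreShuffles {n : ℕ} : (T : Bracketing) → (r : ℕ) → Labels n T → Prop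
  | leaf _, _, _ => True
  | node L R, r, f => IsShuffle r L.size R.size f.1 ∧ AreShuffles L r f.2.1 ∧
      AreShuffles R (r + L.size) f.2.2

/-- The product of all labels; the label of a node is to the left of those below it. -/
def product {n : ℕ} : (T : Bracketing) → Labels n T → Equiv.Perm (Fin n)
  | leaf _, _ => 1
  | node L R, f => f.1 * (product R f.2.2 * product L f.2.1)

/-- The iterated lifting of the shuffles at the nodes. -/
noncomputable def liftLabels (K : Type*) [Field K] {n : ℕ} :
    (T : Bracketing) → (r : ℕ) → Labels n T → MonoidAlgebra K (GVB n)
  | leaf _, _, _ => 1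
  | node L R, r, f => combine K r L.size R.size f.1 (liftLabels K L r f.2.1)
      (liftLabels K R (r + L.size) f.2.2)

open Classical in
/-- The lifting `Q_I(σ)` along the bracketing `T`: decompose `σ` as a product of shuffles, one for
every inner node of `T`, and apply the iterated lifting. It is extended by `0` to the permutations
that have no such decomposition. -/
noncomputable def lift (K : Type*) [Field K] {n : ℕ} (T : Bracketing) (σ : Equiv.Perm (Fin n)) :
    MonoidAlgebra K (GVB n) :=
  if h : ∃ f : Labels n T, T.AreShuffles 0 f ∧ T.product f = σ then T.liftLabels K 0 h.choose else 0

/-- The linear extension `K[𝔖_n] → K[GVB_n⁺]` of the lifting. -/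
noncomputable def linearLift (K : Type*) [Field K] (n : ℕ) (T : Bracketing) :
    MonoidAlgebra K (Equiv.Perm (Fin n)) →ₗ[K] MonoidAlgebra K (GVB n) :=
  Finsupp.linearCombination K (T.lift K) ∘ₗ
    (MonoidAlgebra.coeffLinearEquiv K : MonoidAlgebra K (Equiv.Perm (Fin n)) ≃ₗ[K] _).toLinearMap

end Bracketing

/-- The element `D_{≤ I} = ∑_{σ ∈ des_n(≤ I)} σ` of the group algebra `K[𝔖_n]`. -/
noncomputable def descentSum (K : Type*) [Field K] (n : ℕ) (I : Finset ℕ) :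
    MonoidAlgebra K (Equiv.Perm (Fin n)) :=
  ∑ σ ∈ desLE n I, MonoidAlgebra.of K (Equiv.Perm (Fin n)) σ

/-! ### Braided algebras -/

section Braided

variable {K W : Type*} [Field K] [Ring W] [Algebra K W]

/-- `f ⊗ id` on `W ⊗ W ⊗ W`. -/
noncomputable def on12 (f : W ⊗[K] W →ₗ[K] W ⊗[K] W) :
    Module.End K ((W ⊗[K] W) ⊗[K] W) :=
  f.rTensor W

/-- `id ⊗ f` on `W ⊗ W ⊗ W`. -/
noncomputable def on23 (f : W ⊗[K] W →ₗ[K] W ⊗[K] W) :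
    Module.End K ((W ⊗[K] W) ⊗[K] W) :=
  (TensorProduct.assoc K W W W).symm.toLinearMap ∘ₗ f.lTensor W ∘ₗ
    (TensorProduct.assoc K W W W).toLinearMap

/-- A unital associative algebra `W` together with a linear map `br : W ⊗ W → W ⊗ W` is a unital
braided algebra if `br` satisfies the braid equation, and is compatible with the multiplication and
with the unit. -/
structure IsBraidedAlgebra (br : W ⊗[K] W →ₗ[K] W ⊗[K] W) : Prop where
  braid_eq : on12 br * on23 br * on12 br = on23 br * on12 br * on23 br
  mul_left : br ∘ₗ (LinearMap.mul' K W).rTensor W =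
    (LinearMap.mul' K W).lTensor W ∘ₗ (TensorProduct.assoc K W W W).toLinearMap ∘ₗ
      (on12 br * on23 br)
  mul_right : br ∘ₗ (LinearMap.mul' K W).lTensor W ∘ₗ (TensorProduct.assoc K W W W).toLinearMap =
    (LinearMap.mul' K W).rTensor W ∘ₗ (on23 br * on12 br)
  one_left : ∀ w : W, br (1 ⊗ₜ w) = w ⊗ₜ 1
  one_right : ∀ w : W, br (w ⊗ₜ 1) = 1 ⊗ₜ w

/-- The map `σ^m : v ⊗ w ↦ 1 ⊗ m(v ⊗ w)`. -/
noncomputable def unitMul (K W : Type*) [Field K] [Ring W] [Algebra K W] :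
    W ⊗[K] W →ₗ[K] W ⊗[K] W :=
  TensorProduct.mk K W W 1 ∘ₗ LinearMap.mul' K W

@[simp] lemma unitMul_tmul (x y : W) : unitMul K W (x ⊗ₜ y) = 1 ⊗ₜ (x * y) := rfl

@[simp] lemma on12_tmul (f : W ⊗[K] W →ₗ[K] W ⊗[K] W) (s : W ⊗[K] W) (z : W) :
    on12 f (s ⊗ₜ z) = f s ⊗ₜ z := rfl

@[simp] lemma on23_tmul (f : W ⊗[K] W →ₗ[K] W ⊗[K] W) (x y z : W) :
    on23 f ((x ⊗ₜ y) ⊗ₜ z) = (TensorProduct.assoc K W W W).symm (x ⊗ₜ f (y ⊗ₜ z)) := rfl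

lemma on23_assoc (f : W ⊗[K] W →ₗ[K] W ⊗[K] W) (x : W) (s : W ⊗[K] W) :
    on23 f ((TensorProduct.assoc K W W W).symm (x ⊗ₜ s)) =
      (TensorProduct.assoc K W W W).symm (x ⊗ₜ f s) := by
  simp [on23]

lemma on12_unitMul (u : (W ⊗[K] W) ⊗[K] W) : on12 (unitMul K W) u =
    (TensorProduct.assoc K W W W).symm (1 ⊗ₜ (LinearMap.mul' K W).rTensor W u) := by
  induction u using TensorProduct.induction_on with
  | zero => simp
  | add a b ha hb => simp [ha, hb, TensorProduct.tmul_add]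
  | tmul s z =>
    induction s using TensorProduct.induction_on with
    | zero => simp
    | add a b ha hb => simp_all [TensorProduct.tmul_add, TensorProduct.add_tmul]
    | tmul x y => simp

lemma on12_br_on23_unitMul {br : W ⊗[K] W →ₗ[K] W ⊗[K] W} (h : IsBraidedAlgebra br)
    (u : (W ⊗[K] W) ⊗[K] W) : on12 br (on23 (unitMul K W) u) =
    (TensorProduct.assoc K W W W).symm (1 ⊗ₜ (LinearMap.mul' K W).lTensor W
      (TensorProduct.assoc K W W W u)) := by
  induction u using TensorProduct.induction_on with
  | zero => simp
  | add a b ha hb => simp [ha, hb, TensorProduct.tmul_add]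
  | tmul s z =>
    induction s using TensorProduct.induction_on with
    | zero => simp
    | add a b ha hb => simp_all [TensorProduct.tmul_add, TensorProduct.add_tmul]
    | tmul x y => simp [h.one_right]

lemma virt_rel : on12 (unitMul K W) * on23 (unitMul K W) * on12 (unitMul K W) =
    on23 (unitMul K W) * on12 (unitMul K W) * on23 (unitMul K W) := by
  ext x y z
  simp [mul_assoc]

lemma mixed_left_rel {br : W ⊗[K] W →ₗ[K] W ⊗[K] W} (h : IsBraidedAlgebra br) :
    on12 (unitMul K W) * on23 br * on12 br = on23 br * on12 br * on23 (unitMul K W) := by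
  refine LinearMap.ext fun u => ?_
  have := LinearMap.congr_fun h.mul_right u
  simp only [LinearMap.comp_apply, LinearEquiv.coe_coe, Module.End.mul_apply] at this
  simp only [Module.End.mul_apply]
  rw [on12_unitMul, on12_br_on23_unitMul h, on23_assoc, this]

lemma mixed_right_rel {br : W ⊗[K] W →ₗ[K] W ⊗[K] W} (h : IsBraidedAlgebra br) :
    on23 (unitMul K W) * on12 br * on23 br = on12 br * on23 br * on12 (unitMul K W) := by
  refine LinearMap.ext fun u => ?_
  have := LinearMap.congr_fun h.mul_left u
  simp only [LinearMap.comp_apply, LinearEquiv.coe_coe, Module.End.mul_apply] at this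
  simp only [Module.End.mul_apply]
  rw [on12_unitMul, on23_assoc, this]
  generalize on12 br (on23 br u) = v
  induction v using TensorProduct.induction_on with
  | zero => simp
  | add a b ha hb => simp_all [TensorProduct.tmul_add]
  | tmul s z =>
    induction s using TensorProduct.induction_on with
    | zero => simp
    | add a b ha hb => simp_all [TensorProduct.tmul_add, TensorProduct.add_tmul]
    | tmul x y => simp [h.one_left]

/-! ### Operators on two tensor factors -/

variable {n : ℕ}

/-- Put the two factors of an element of `W ⊗ W` at the positions `a` and `b` of a pure tensor. -/
noncomputable def place2 (K : Type*) {W : Type*} [Field K] [Ring W] [Algebra K W] {n : ℕ}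
    {a b : Fin n} (hab : a ≠ b) (v : Fin n → W) : W ⊗[K] W →ₗ[K] ⨂[K]^n W :=
  TensorProduct.lift (LinearMap.mk₂ K
    (fun x y => PiTensorProduct.tprod K (Function.update (Function.update v a x) b y))
    (fun x x' y => by
      simp only [Function.update_comm hab, MultilinearMap.map_update_add])
    (fun c x y => by
      simp only [Function.update_comm hab, MultilinearMap.map_update_smul])
    (fun x y y' => by simp only [MultilinearMap.map_update_add])
    (fun c x y => by simp only [MultilinearMap.map_update_smul]))

lemma place2_tmul {a b : Fin n} (hab : a ≠ b) (v : Fin n → W) (x y : W) :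
    place2 K hab v (x ⊗ₜ y) =
      PiTensorProduct.tprod K (Function.update (Function.update v a x) b y) := by
  simp [place2]

lemma place2_update_left {a b : Fin n} (hab : a ≠ b) (v : Fin n → W) (x : W) :
    place2 K hab (Function.update v a x) = place2 K hab v := by
  ext y z
  simp [place2_tmul]

lemma place2_update_right {a b : Fin n} (hab : a ≠ b) (v : Fin n → W) (x : W) :
    place2 K hab (Function.update v b x) = place2 K hab v := by
  ext y z
  simp [place2_tmul, Function.update_comm hab]

lemma place2_update_add {a b c : Fin n} (hab : a ≠ b) (hc : c ≠ a) (hc' : c ≠ b) (v : Fin n → W)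
    (x y : W) : place2 K hab (Function.update v c (x + y)) =
      place2 K hab (Function.update v c x) + place2 K hab (Function.update v c y) := by
  ext z w
  simp [place2_tmul, Function.update_comm hc, Function.update_comm hc']

lemma place2_update_smul {a b c : Fin n} (hab : a ≠ b) (hc : c ≠ a) (hc' : c ≠ b) (v : Fin n → W)
    (k : K) (x : W) : place2 K hab (Function.update v c (k • x)) =
      k • place2 K hab (Function.update v c x) := by
  ext z w
  simp [place2_tmul, Function.update_comm hc, Function.update_comm hc']

/-- The operator on `W^{⊗n}` which applies `f` to the tensor factors at the positions `a`, `b`. -/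
noncomputable def opAt (f : W ⊗[K] W →ₗ[K] W ⊗[K] W) {a b : Fin n} (hab : a ≠ b) :
    Module.End K (⨂[K]^n W) :=
  PiTensorProduct.lift
    { toFun := fun v => place2 K hab v (f (v a ⊗ₜ v b))
      map_update_add' := by
        intro inst v c x y
        obtain rfl : inst = instDecidableEqFin n := Subsingleton.elim _ _
        by_cases hca : c = a
        · subst hca
          simp [place2_update_left, hab.symm, TensorProduct.add_tmul]
        by_cases hcb : c = b
        · subst hcb
          simp [place2_update_right, hab, TensorProduct.tmul_add]
        simp [place2_update_add hab hca hcb, Ne.symm hca, Ne.symm hcb]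
      map_update_smul' := by
        intro inst v c k x
        obtain rfl : inst = instDecidableEqFin n := Subsingleton.elim _ _
        by_cases hca : c = a
        · subst hca
          simp [place2_update_left, hab.symm, ← TensorProduct.smul_tmul']
        by_cases hcb : c = b
        · subst hcb
          simp [place2_update_right, hab]
        simp [place2_update_smul hab hca hcb, Ne.symm hca, Ne.symm hcb] }

lemma opAt_tprod (f : W ⊗[K] W →ₗ[K] W ⊗[K] W) {a b : Fin n} (hab : a ≠ b) (v : Fin n → W) :
    opAt f hab (PiTensorProduct.tprod K v) = place2 K hab v (f (v a ⊗ₜ v b)) := by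
  simp [opAt]

/-- Put the factors of an element of `W ⊗ W ⊗ W` at three positions of a pure tensor. -/
noncomputable def place3 (K : Type*) {W : Type*} [Field K] [Ring W] [Algebra K W] {n : ℕ}
    {a b c : Fin n} (hab : a ≠ b) (hac : a ≠ c) (hbc : b ≠ c) (v : Fin n → W) :
    (W ⊗[K] W) ⊗[K] W →ₗ[K] ⨂[K]^n W :=
  TensorProduct.lift (LinearMap.flip
    { toFun := fun z => place2 K hab (Function.update v c z)
      map_add' := place2_update_add hab hac.symm hbc.symm v
      map_smul' := fun k z => place2_update_smul hab hac.symm hbc.symm v k z })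

lemma place3_tmul {a b c : Fin n} (hab : a ≠ b) (hac : a ≠ c) (hbc : b ≠ c) (v : Fin n → W)
    (s : W ⊗[K] W) (z : W) : place3 K hab hac hbc v (s ⊗ₜ z) =
      place2 K hab (Function.update v c z) s := by
  simp [place3]

lemma place3_assoc {a b c : Fin n} (hab : a ≠ b) (hac : a ≠ c) (hbc : b ≠ c) (v : Fin n → W)
    (x : W) (s : W ⊗[K] W) :
    place3 K hab hac hbc v ((TensorProduct.assoc K W W W).symm (x ⊗ₜ s)) =
      place2 K hbc (Function.update v a x) s := by
  induction s using TensorProduct.induction_on with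
  | zero => simp
  | add s t hs ht => simp [TensorProduct.tmul_add, hs, ht]
  | tmul y z =>
    rw [TensorProduct.assoc_symm_tmul, place3_tmul, place2_tmul, place2_tmul,
      Function.update_comm hac.symm, Function.update_comm hbc.symm]

lemma opAt_place3_left (f : W ⊗[K] W →ₗ[K] W ⊗[K] W) {a b c : Fin n} (hab : a ≠ b) (hac : a ≠ c)
    (hbc : b ≠ c) (v : Fin n → W) (u : (W ⊗[K] W) ⊗[K] W) :
    opAt f hab (place3 K hab hac hbc v u) = place3 K hab hac hbc v (on12 f u) := by
  suffices h : opAt f hab ∘ₗ place3 K hab hac hbc v = place3 K hab hac hbc v ∘ₗ on12 f from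
    LinearMap.congr_fun h u
  ext x y z
  simp [place3_tmul, place2_tmul, opAt_tprod, place2_update_left, place2_update_right, hab]

lemma opAt_place3_right (f : W ⊗[K] W →ₗ[K] W ⊗[K] W) {a b c : Fin n} (hab : a ≠ b) (hac : a ≠ c)
    (hbc : b ≠ c) (v : Fin n → W) (u : (W ⊗[K] W) ⊗[K] W) :
    opAt f hbc (place3 K hab hac hbc v u) = place3 K hab hac hbc v (on23 f u) := by
  suffices h : opAt f hbc ∘ₗ place3 K hab hac hbc v = place3 K hab hac hbc v ∘ₗ on23 f from
    LinearMap.congr_fun h u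
  ext x y z
  simp only [TensorProduct.AlgebraTensorModule.curry_apply, TensorProduct.curry_apply,
    LinearMap.coe_restrictScalars, LinearMap.comp_apply, on23_tmul, place3_assoc]
  rw [place3_tmul, place2_tmul, Function.update_comm hac.symm, Function.update_comm hbc.symm,
    opAt_tprod, place2_update_right, place2_update_left]
  simp [hbc]

lemma tprod_eq_place3 {a b c : Fin n} (hab : a ≠ b) (hac : a ≠ c) (hbc : b ≠ c) (v : Fin n → W) :
    PiTensorProduct.tprod K v = place3 K hab hac hbc v ((v a ⊗ₜ v b) ⊗ₜ v c) := by
  rw [place3_tmul, place2_tmul]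
  simp

lemma opAt_three (f g h f' g' h' : W ⊗[K] W →ₗ[K] W ⊗[K] W) {a b c : Fin n} (hab : a ≠ b)
    (hac : a ≠ c) (hbc : b ≠ c) (H : on12 f * on23 g * on12 h = on23 f' * on12 g' * on23 h') :
    opAt f hab * opAt g hbc * opAt h hab = opAt f' hbc * opAt g' hab * opAt h' hbc := by
  refine PiTensorProduct.ext (MultilinearMap.ext fun v => ?_)
  simp only [LinearMap.compMultilinearMap_apply, Module.End.mul_apply]
  rw [tprod_eq_place3 (K := K) hab hac hbc v]
  simp only [opAt_place3_left, opAt_place3_right]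
  exact congrArg _ (LinearMap.congr_fun H _)

/-- Put the factors of two elements of `W ⊗ W` at four positions of a pure tensor. -/
noncomputable def place4 (K : Type*) {W : Type*} [Field K] [Ring W] [Algebra K W] {n : ℕ}
    {a b c d : Fin n} (hab : a ≠ b) (hcd : c ≠ d) (hac : a ≠ c) (had : a ≠ d) (hbc : b ≠ c)
    (hbd : b ≠ d) (v : Fin n → W) : W ⊗[K] W →ₗ[K] W ⊗[K] W →ₗ[K] ⨂[K]^n W :=
  TensorProduct.lift (LinearMap.mk₂ K
    (fun x y => place2 K hcd (Function.update (Function.update v a x) b y))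
    (fun x x' y => by
      simp only [Function.update_comm hab]
      exact place2_update_add hcd hac had _ _ _)
    (fun k x y => by
      simp only [Function.update_comm hab]
      exact place2_update_smul hcd hac had _ _ _)
    (fun x y y' => place2_update_add hcd hbc hbd _ _ _)
    (fun k x y => place2_update_smul hcd hbc hbd _ _ _))

lemma opAt_comm (f g : W ⊗[K] W →ₗ[K] W ⊗[K] W) {a b c d : Fin n} (hab : a ≠ b) (hcd : c ≠ d)
    (hac : a ≠ c) (had : a ≠ d) (hbc : b ≠ c) (hbd : b ≠ d) :
    opAt f hab * opAt g hcd = opAt g hcd * opAt f hab := by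
  refine PiTensorProduct.ext (MultilinearMap.ext fun v => ?_)
  simp only [LinearMap.compMultilinearMap_apply, Module.End.mul_apply, opAt_tprod]
  have key : ∀ (s : W ⊗[K] W) (z w : W), place4 K hab hcd hac had hbc hbd v s (z ⊗ₜ w) =
      place2 K hab (Function.update (Function.update v c z) d w) s := by
    intro s z w
    induction s using TensorProduct.induction_on with
    | zero => simp
    | add s t hs ht => simp [hs, ht]
    | tmul x y =>
      simp only [place4, TensorProduct.lift.tmul, LinearMap.mk₂_apply, place2_tmul]
      rw [Function.update_comm hbc, Function.update_comm hac, Function.update_comm hbd,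
        Function.update_comm had]
  have h1 : ∀ t : W ⊗[K] W, opAt f hab (place2 K hcd v t) =
      place4 K hab hcd hac had hbc hbd v (f (v a ⊗ₜ v b)) t := by
    intro t
    induction t using TensorProduct.induction_on with
    | zero => simp
    | add s t hs ht => simp [hs, ht]
    | tmul z w =>
      rw [place2_tmul, opAt_tprod, key]
      simp [hac, had, hbc, hbd]
  have h2 : ∀ s : W ⊗[K] W, opAt g hcd (place2 K hab v s) =
      place4 K hab hcd hac had hbc hbd v s (g (v c ⊗ₜ v d)) := by
    intro s
    induction s using TensorProduct.induction_on with
    | zero => simp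
    | add s t hs ht => simp [hs, ht]
    | tmul x y =>
      rw [place2_tmul, opAt_tprod]
      simp [place4, hac.symm, had.symm, hbc.symm, hbd.symm]
  rw [h1, h2]

/-- The operator `id^{⊗(i-1)} ⊗ f ⊗ id^{⊗(n-i-1)}` on `W^{⊗n}`. -/
noncomputable def localOp (f : W ⊗[K] W →ₗ[K] W ⊗[K] W) (i : {i : ℕ // 1 ≤ i ∧ i < n}) :
    Module.End K (⨂[K]^n W) :=
  opAt f (a := ⟨i.1 - 1, by omega⟩) (b := ⟨i.1, i.2.2⟩) (by
    have := i.2.1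
    simp only [ne_eq, Fin.mk.injEq]
    omega)

lemma localOp_comm (f g : W ⊗[K] W →ₗ[K] W ⊗[K] W) (i j : {i : ℕ // 1 ≤ i ∧ i < n})
    (h : i.1 + 1 < j.1 ∨ j.1 + 1 < i.1) :
    localOp f i * localOp g j = localOp g j * localOp f i := by
  have hi := i.2.1
  have hj := j.2.1
  apply opAt_comm <;> simp only [ne_eq, Fin.mk.injEq] <;> omega

lemma localOp_three (f g h f' g' h' : W ⊗[K] W →ₗ[K] W ⊗[K] W) (i j : {i : ℕ // 1 ≤ i ∧ i < n})
    (hij : j.1 = i.1 + 1) (H : on12 f * on23 g * on12 h = on23 f' * on12 g' * on23 h') :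
    localOp f i * localOp g j * localOp h i = localOp f' j * localOp g' i * localOp h' j := by
  obtain ⟨i, hi⟩ := i
  obtain ⟨j, hj⟩ := j
  obtain rfl : j = i + 1 := hij
  refine opAt_three f g h f' g' h' _ ?_ _ H
  simp only [ne_eq, Fin.mk.injEq]
  omega

/-- The operators by which the generators act: `σ_i` by the braiding and `ξ_i` by `σ^m`. -/
noncomputable def genOp (br : W ⊗[K] W →ₗ[K] W ⊗[K] W) : GVBGen n → Module.End K (⨂[K]^n W)
  | GVBGen.braid i => localOp br i
  | GVBGen.virt i => localOp (unitMul K W) i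

/-- The representation of `K[GVB_n⁺]` on `W^{⊗n}` for a unital braided algebra `W`. -/
noncomputable def rep {br : W ⊗[K] W →ₗ[K] W ⊗[K] W} (h : IsBraidedAlgebra br) (n : ℕ) :
    MonoidAlgebra K (GVB n) →ₐ[K] Module.End K (⨂[K]^n W) :=
  MonoidAlgebra.lift K (Module.End K (⨂[K]^n W)) (GVB n)
    (PresentedMonoid.lift (genOp br) (by
      intro x y hxy
      cases hxy with
      | comm_braid_braid i j hij => simpa [genOp] using localOp_comm br br i j hij
      | comm_braid_virt i j hij => simpa [genOp] using localOp_comm br (unitMul K W) i j hij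
      | comm_virt_virt i j hij =>
        simpa [genOp] using localOp_comm (unitMul K W) (unitMul K W) i j hij
      | braid_braid i j hij => simpa [genOp] using localOp_three _ _ _ _ _ _ i j hij h.braid_eq
      | virt_virt i j hij => simpa [genOp] using localOp_three _ _ _ _ _ _ i j hij virt_rel
      | mixed_left i j hij =>
        simpa [genOp] using localOp_three _ _ _ _ _ _ i j hij (mixed_left_rel h)
      | mixed_right i j hij =>
        simpa [genOp] using (localOp_three _ _ _ _ _ _ i j hij (mixed_right_rel h).symm).symm))

end Braided

end QuasiShuffle

/-! The liftings of all shuffles of two words add up to an operator, the braided quasi-shuffle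
product, and this product is associative. A bracketing of the blocks is a bracketing of an iterated
product, so its choice does not matter.

The product is built from `s i`, which braids the letters at the positions `i`, `i + 1` (counted
from 0), and `X i`, which multiplies them and carries the resulting unit to the very left. The last
letter of a quasi-shuffle is the last letter of the right word, that of the left word, or the
product of both. This gives the three-term recursion `shuffleSum`. Every product shortens the words
and shifts positions, so later operators depend on the number `m` of units created so far. Sums
therefore carry a continuation `k`, where `k m` is what is applied after a term with `m` units.

Associativity, `leftTriple_eq_rightTriple`, is an induction on the total length: both bracketings of
three words satisfy the same seven-term recursion, with one term for each nonempty set of last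
letters that are multiplied to form the last letter of the result. It uses only the identities
`FusionRel`. Of these, `over_right`, `assoc` and `fuse_far` are verified for operators, because they
rest on the flip-like braiding of units and on associativity in `W`; this is why images in the
endomorphism ring are compared. By `quasiSum_assoc` every bracketing can be turned into the one from
the right with the same block lengths, and these lengths are determined by the cuts and the size.

The link with the liftings is `IsShuffle.shuffleLift_mul_moveCycle`: sending the last left letter to
the end of the block changes a lifting by the second and third term of the recursion. Hence
`sum_weightedRep_shuffleLift` for one node and `sum_weightedRep_liftLabels` for a whole bracketing.
Uniqueness of the decomposition into shuffles (`product_injective`) identifies the lifting of the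
descent sum with the sum over all labels. -/

namespace QuasiShuffle

/-! ### Quasi-shuffles of two words as operators. -/

section Fusion

variable {E : Type*} [Ring E]

/-- The product `s (a + l - 1) ⋯ s (a + 1) s a`, which moves the letter at position `a` to the right
over `l` letters. -/
def moveRight (s : ℕ → E) (a : ℕ) : ℕ → E
  | 0 => 1
  | l + 1 => s (a + l) * moveRight s a l

/-- Relations between the operators `s i`, which braid the letters at positions `i`, `i + 1`, and
`X i`, which multiply these letters and put a unit to the very left, for `i + 1 < n`. -/
structure FusionRel (n : ℕ) (s X : ℕ → E) : Prop where
  comm : ∀ i j, i + 2 ≤ j → j + 1 < n → s i * s j = s j * s i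
  braid : ∀ i, i + 2 < n → s i * s (i + 1) * s i = s (i + 1) * s i * s (i + 1)
  -- The unit arriving at the very left pushes all letters in front of the product one position to
  -- the right; the letters behind it stay, as in `far`.
  shift : ∀ i m, i + 2 ≤ m → m + 1 < n → s (i + 1) * X m = X m * s i
  far : ∀ i m, m + 2 ≤ i → i + 1 < n → s i * X m = X m * s i
  over_right : ∀ m, m + 2 < n → s (m + 1) * X m = X (m + 1) * s m * s (m + 1)
  over_left : ∀ m, m + 2 < n → s (m + 1) * X (m + 1) = X m * s (m + 1) * s m
  assoc : ∀ m, m + 2 < n → X (m + 1) * X m = X (m + 1) * X (m + 1)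
  fuse_far : ∀ i j, i + 2 ≤ j → j + 1 < n → X (i + 1) * X j = X j * X i

/-- The sum over the quasi-shuffles of the `p` letters at the positions `e, …, e + p - 1` with the
following `q` letters, where the terms which create `m` units are multiplied by `k m`. -/
def shuffleSum (s X : ℕ → E) : ℕ → ℕ → ℕ → (ℕ → E) → E
  | _, 0, _, k => k 0
  | _, _ + 1, 0, k => k 0
  | e, p + 1, q + 1, k =>
    -- The last letter of the result is that of the right word, that of the left word, or their
    -- product. In the third case the product remains at position `e + p + q + 1`, and the new unit
    -- pushes the remaining letters to the positions from `e + 1` on.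
    shuffleSum s X e (p + 1) q k + shuffleSum s X e p (q + 1) k * moveRight s (e + p) (q + 1) +
      shuffleSum s X (e + 1) p q (fun m => k (m + 1)) *
        (X (e + p + q) * moveRight s (e + p) q)
termination_by _ p q _ => p + q

variable {n : ℕ} {s X : ℕ → E}

@[simp] lemma moveRight_zero (a : ℕ) : moveRight s a 0 = 1 := rfl

lemma moveRight_succ (a l : ℕ) : moveRight s a (l + 1) = s (a + l) * moveRight s a l := rfl

lemma moveRight_add (a l m : ℕ) :
    moveRight s a (l + m) = moveRight s (a + l) m * moveRight s a l := by
  induction m with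
  | zero => simp
  | succ m ih => rw [← add_assoc, moveRight_succ, ih, moveRight_succ, mul_assoc, add_assoc]

lemma moveRight_shift {y : E} {a b l : ℕ} (h : ∀ j < l, s (b + j) * y = y * s (a + j)) :
    moveRight s b l * y = y * moveRight s a l := by
  induction l with
  | zero => simp
  | succ l ih =>
    rw [moveRight_succ, moveRight_succ, mul_assoc, ih (fun j hj => h j (by omega)), ← mul_assoc,
      h l (by omega), mul_assoc]

@[simp] lemma shuffleSum_zero_left (e q : ℕ) (k : ℕ → E) : shuffleSum s X e 0 q k = k 0 := by
  rw [shuffleSum]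

@[simp] lemma shuffleSum_zero_right (e p : ℕ) (k : ℕ → E) : shuffleSum s X e p 0 k = k 0 := by
  cases p <;> rw [shuffleSum]

lemma shuffleSum_succ (e p q : ℕ) (k : ℕ → E) : shuffleSum s X e (p + 1) (q + 1) k =
    shuffleSum s X e (p + 1) q k + shuffleSum s X e p (q + 1) k * moveRight s (e + p) (q + 1) +
      shuffleSum s X (e + 1) p q (fun m => k (m + 1)) *
        (X (e + p + q) * moveRight s (e + p) q) := by
  rw [shuffleSum]

/-- Every product uses up a letter of either word, so at most `min p q` units are created. -/
lemma shuffleSum_congr {e p q : ℕ} {k k' : ℕ → E} (h : ∀ m ≤ p, m ≤ q → k m = k' m) :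
    shuffleSum s X e p q k = shuffleSum s X e p q k' := by
  induction p generalizing e q k k' with
  | zero => simp [h]
  | succ p ihp =>
    induction q generalizing e k k' with
    | zero => simp [h]
    | succ q ihq =>
      rw [shuffleSum_succ, shuffleSum_succ, ihq fun m h1 h2 => h m h1 (by omega),
        ihp fun m h1 h2 => h m (by omega) h2,
        ihp fun m h1 h2 => h (m + 1) (by omega) (by omega)]

lemma shuffleSum_add (e p q : ℕ) (k k' : ℕ → E) :
    shuffleSum s X e p q (fun m => k m + k' m) =
      shuffleSum s X e p q k + shuffleSum s X e p q k' := by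
  induction p generalizing e q k k' with
  | zero => simp
  | succ p ihp =>
    induction q generalizing e k k' with
    | zero => simp
    | succ q ihq =>
      simp only [shuffleSum_succ, ihq, ihp, add_mul]
      abel

namespace FusionRel

variable (H : FusionRel n s X)
include H

lemma commute_moveRight {i a l : ℕ} (h : a + l < i) (hi : i + 1 < n) :
    s i * moveRight s a l = moveRight s a l * s i := by
  refine (moveRight_shift fun j hj => ?_).symm
  exact H.comm _ _ (by omega) hi

lemma commute_moveRight_left {i a l : ℕ} (h : i + 2 ≤ a) (hl : a + l < n) :
    s i * moveRight s a l = moveRight s a l * s i :=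
  (moveRight_shift fun _ _ => (H.comm _ _ (by omega) (by omega)).symm).symm

lemma moveRight_comm {a l b m : ℕ} (h : a + l < b) (hm : b + m < n) :
    moveRight s b m * moveRight s a l = moveRight s a l * moveRight s b m :=
  moveRight_shift fun _ _ => H.commute_moveRight (by omega) (by omega)

/-- The braid relation: a crossing of two letters about to be passed by the moving letter becomes
the same crossing one position further left after the passage. -/
lemma moveRight_braid {f i l : ℕ} (h1 : f ≤ i) (h2 : i + 1 < f + l) (hn : f + l < n) :
    moveRight s f l * s (i + 1) = s i * moveRight s f l := by
  -- The move consists of `d` steps before the crossing is met, two steps past it, and `c` steps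
  -- after it; only the middle two fail to commute with the crossing.
  obtain ⟨d, rfl⟩ := Nat.exists_eq_add_of_le h1
  obtain ⟨c, rfl⟩ := Nat.exists_eq_add_of_le (show d + 2 ≤ l by omega)
  rw [moveRight_add, moveRight_succ, moveRight_succ]
  have e1 := H.commute_moveRight (i := f + d + 1) (a := f) (l := d) (by omega) (by omega)
  have e2 := H.commute_moveRight_left (i := f + d) (a := f + (d + 2)) (l := c) (by omega) (by omega)
  have e3 := H.braid (f + d) (by omega)
  simp only [← add_assoc] at *
  calc moveRight s (f + d + 2) c * (s (f + d + 1) * (s (f + d) * moveRight s f d)) * s (f + d + 1)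
      = moveRight s (f + d + 2) c * (s (f + d + 1) * s (f + d) *
          (moveRight s f d * s (f + d + 1))) := by noncomm_ring
    _ = moveRight s (f + d + 2) c * (s (f + d + 1) * s (f + d) * s (f + d + 1)) *
          moveRight s f d := by rw [← e1]; noncomm_ring
    _ = moveRight s (f + d + 2) c * s (f + d) * (s (f + d + 1) * s (f + d)) *
          moveRight s f d := by rw [← e3]; noncomm_ring
    _ = _ := by rw [← e2]; noncomm_ring

lemma moveRight_moveRight {f i l m : ℕ} (h1 : f ≤ i) (h2 : i + m < f + l) (hn : f + l < n) :
    moveRight s f l * moveRight s (i + 1) m = moveRight s i m * moveRight s f l := by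
  refine (moveRight_shift fun j hj => ?_).symm
  rw [← H.moveRight_braid (by omega) (by omega) hn]
  congr 2
  omega

lemma moveRight_mul_X {a l m : ℕ} (h : a + l < m) (hm : m + 1 < n) :
    moveRight s (a + 1) l * X m = X m * moveRight s a l :=
  moveRight_shift fun j hj => by
    rw [← H.shift _ _ (by omega) hm]
    congr 2
    omega

/-- A letter moves to the left over a product. -/
lemma moveRight_succ_mul_X {a t : ℕ} (hn : a + t + 1 < n) :
    moveRight s (a + 1) t * X a = X (a + t) * moveRight s a t * moveRight s (a + 1) t := by
  induction t with
  | zero => simp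
  | succ t ih =>
    have e1 := H.over_right (a + t) (by omega)
    have e2 := H.commute_moveRight (i := a + t + 1) (a := a) (l := t) (by omega) (by omega)
    rw [moveRight_succ, mul_assoc, ih (by omega), moveRight_succ a, add_right_comm a 1 t]
    simp only [← mul_assoc, ← add_assoc, e1]
    simp only [mul_assoc]
    rw [← mul_assoc (moveRight s a t), ← e2]
    simp only [mul_assoc]

/-- A letter moves to the right over a product. -/
lemma moveRight_mul_X_last {f l : ℕ} (hn : f + l + 2 < n) :
    moveRight s (f + 1) (l + 1) * X (f + l + 1) = X (f + l) * moveRight s f (l + 2) := by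
  rw [moveRight_succ, mul_assoc, H.moveRight_mul_X (by omega) (by omega), moveRight_succ,
    moveRight_succ, add_right_comm f 1 l, ← mul_assoc, H.over_left _ (by omega)]
  simp only [mul_assoc, ← add_assoc]

/-- The crossing takes place behind both words, and letters there are not moved by units inserted on
the left. -/
lemma shuffleSum_mul_s {e p q i : ℕ} (k : ℕ → E) (h : e + p + q ≤ i) (hi : i + 1 < n) :
    shuffleSum s X e p q (fun m => k m * s i) = shuffleSum s X e p q k * s i := by
  induction p generalizing e q k with
  | zero => simp
  | succ p ihp =>
    induction q generalizing e k with
    | zero => simp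
    | succ q ihq =>
      rw [shuffleSum_succ, shuffleSum_succ, ihq _ (by omega), ihp _ (by omega),
        ihp (fun m => k (m + 1)) (by omega), add_mul, add_mul]
      simp only [mul_assoc]
      rw [← H.commute_moveRight (a := e + p) (l := q + 1) (by omega) hi,
        ← H.commute_moveRight (a := e + p) (l := q) (by omega) hi,
        ← mul_assoc (s i), H.far _ _ (by omega) hi, mul_assoc]

lemma shuffleSum_mul_moveRight {e p q a l : ℕ} (k : ℕ → E) (h : e + p + q ≤ a) (hl : a + l < n) :
    shuffleSum s X e p q (fun m => k m * moveRight s a l) =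
      shuffleSum s X e p q k * moveRight s a l := by
  induction l generalizing k with
  | zero => simp
  | succ l ih =>
    simp only [moveRight_succ, ← mul_assoc]
    rw [ih _ (by omega), H.shuffleSum_mul_s _ (by omega) (by omega)]

/-- A product formed behind both words puts a unit in front of them, so that they start one position
later. -/
lemma shuffleSum_mul_X {e p q j : ℕ} (k : ℕ → E) (h : e + p + q ≤ j) (hj : j + 1 < n) :
    shuffleSum s X e p q (fun m => k m * X j) = shuffleSum s X (e + 1) p q k * X j := by
  induction p generalizing e q k with
  | zero => simp
  | succ p ihp =>
    induction q generalizing e k with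
    | zero => simp
    | succ q ihq =>
      rw [shuffleSum_succ, shuffleSum_succ, ihq _ (by omega), ihp _ (by omega),
        ihp (fun m => k (m + 1)) (by omega), add_mul, add_mul]
      simp only [mul_assoc]
      rw [show e + 1 + p = e + p + 1 by omega, show e + p + 1 + q = e + p + q + 1 by omega,
        H.moveRight_mul_X (by omega) hj, H.moveRight_mul_X (by omega) hj,
        ← mul_assoc (X _) (X j), H.fuse_far _ _ (by omega) hj, mul_assoc]

/-- A letter moves to the right over a quasi-shuffle product. -/
lemma shuffleSum_mul_moveRight_left {f q t : ℕ} (k : ℕ → E) (h : f + q + t < n) :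
    shuffleSum s X (f + 1) q t (fun m => k m * moveRight s (f + m) (q + t - m)) =
      shuffleSum s X f q t k * moveRight s f (q + t) := by
  induction q generalizing f t k with
  | zero => simp
  | succ q ihq =>
    induction t generalizing f k with
    | zero => simp
    | succ t iht =>
      rw [shuffleSum_succ, shuffleSum_succ, add_mul, add_mul]
      congr 1
      · congr 1
        -- In each of the three cases the final step of the moving letter is split off. Once the
        -- letter has left position `f`, the remaining words end at `f + q + t`, so that this step
        -- acts behind them and comes out of the sum.
        · rw [shuffleSum_congr (k' := fun m => k m * s (f + q + 1 + t) *
            moveRight s (f + m) (q + 1 + t - m)), iht _ (by omega),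
            H.shuffleSum_mul_s _ (by omega) (by omega), mul_assoc]
          · rw [← add_assoc, moveRight_succ]
            simp only [add_assoc]
          · intro m h1 h2
            rw [show q + 1 + (t + 1) - m = q + 1 + t - m + 1 by omega, moveRight_succ, mul_assoc,
              show f + m + (q + 1 + t - m) = f + q + 1 + t by omega]
        · rw [shuffleSum_congr (k' := fun m => k m * s (f + q + 1 + t) *
            moveRight s (f + m) (q + (t + 1) - m)), ihq _ (by omega),
            H.shuffleSum_mul_s _ (by omega) (by omega), mul_assoc, mul_assoc, mul_assoc,
            show q + 1 + (t + 1) = q + (t + 1) + 1 by omega, ← H.moveRight_moveRight (i := f + q)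
            (by omega) (by omega) (by omega), moveRight_succ (s := s) f,
            show f + (q + (t + 1)) = f + q + 1 + t by omega,
            mul_assoc, show f + 1 + q = f + q + 1 by omega]
          intro m h1 h2
          rw [show q + 1 + (t + 1) - m = q + (t + 1) - m + 1 by omega, moveRight_succ, mul_assoc,
            show f + m + (q + (t + 1) - m) = f + q + 1 + t by omega]
      -- Passing a product amounts to passing both factors before they are multiplied, hence the `q
      -- + t + 2` steps; this is `moveRight_mul_X_last`.
      · rw [shuffleSum_congr (k' := fun m => k (m + 1) * s (f + q + 1 + t) *
          moveRight s (f + 1 + m) (q + t - m)), ihq (f := f + 1) (fun m => _) (by omega),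
          H.shuffleSum_mul_s (fun m => k (m + 1)) (by omega) (by omega), mul_assoc, mul_assoc,
          mul_assoc, mul_assoc, show q + 1 + (t + 1) = q + t + 2 by omega,
          ← H.moveRight_moveRight (by omega) (by omega) (by omega),
          ← mul_assoc (X (f + q + t)), show f + q + t = f + (q + t) by omega,
          ← H.moveRight_mul_X_last (by omega), moveRight_succ]
        · rw [show f + 1 + q + t = f + (q + t) + 1 by omega,
            show f + q + 1 + t = f + (q + t) + 1 by omega,
            show f + 1 + (q + t) = f + (q + t) + 1 by omega, show f + 1 + q = f + q + 1 by omega]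
          simp only [mul_assoc]
        · intro m h1 h2
          rw [show q + 1 + (t + 1) - (m + 1) = q + t - m + 1 by omega, moveRight_succ, mul_assoc,
            show f + (m + 1) = f + 1 + m by omega,
            show f + 1 + m + (q + t - m) = f + q + 1 + t by omega]

end FusionRel

end Fusion

/-! ### Associativity of the quasi-shuffle product of three words. -/

section Triple

variable {E : Type*} [Ring E] {n : ℕ} {s X : ℕ → E}

/-- The sum over the quasi-shuffles of three adjacent words, bracketed on the left. -/
def leftTriple (s X : ℕ → E) (e p q t : ℕ) (k : ℕ → E) : E :=
  shuffleSum s X e p q fun m => shuffleSum s X (e + m) (p + q - m) t fun j => k (m + j)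

/-- The sum over the quasi-shuffles of three adjacent words, bracketed on the right. -/
def rightTriple (s X : ℕ → E) (e p q t : ℕ) (k : ℕ → E) : E :=
  shuffleSum s X (e + p) q t fun m => shuffleSum s X (e + m) p (q + t - m) fun j => k (m + j)

namespace FusionRel

variable (H : FusionRel n s X)
include H

/-- The summands belong to the sets of words whose last letters form the last letter of the result:
third, second, first word; first and second; second and third; first and third; all three. -/
lemma leftTriple_succ (e p q t : ℕ) (k : ℕ → E) (h : e + p + q + t + 3 ≤ n) :
    leftTriple s X e (p + 1) (q + 1) (t + 1) k =
      leftTriple s X e (p + 1) (q + 1) t k +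
      leftTriple s X e (p + 1) q (t + 1) k * moveRight s (e + p + q + 1) (t + 1) +
      leftTriple s X e p (q + 1) (t + 1) k * moveRight s (e + p) (q + t + 2) +
      leftTriple s X (e + 1) p q (t + 1) (fun m => k (m + 1)) *
        (moveRight s (e + p + q + 1) (t + 1) * X (e + p + q) * moveRight s (e + p) q) +
      leftTriple s X (e + 1) (p + 1) q t (fun m => k (m + 1)) *
        (X (e + p + q + t + 1) * moveRight s (e + p + q + 1) t) +
      leftTriple s X (e + 1) p (q + 1) t (fun m => k (m + 1)) *
        (X (e + p + q + t + 1) * moveRight s (e + p) (q + t + 1)) +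
      leftTriple s X (e + 2) p q t (fun m => k (m + 2)) *
        (X (e + p + q + t + 1) * moveRight s (e + p + q + 1) t * X (e + p + q) *
          moveRight s (e + p) q) := by
  have hC1 : moveRight s (e + p) (q + t + 2) =
      moveRight s (e + p + q + 1) (t + 1) * moveRight s (e + p) (q + 1) := by
    rw [show q + t + 2 = q + 1 + (t + 1) by omega, moveRight_add, ← add_assoc]
  have hC2 : moveRight s (e + p) (q + t + 1) =
      moveRight s (e + p + q + 1) t * moveRight s (e + p) (q + 1) := by
    rw [show q + t + 1 = q + 1 + t by omega, moveRight_add, ← add_assoc]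
  -- In the outer recursion, `B` remains when the last letter of the combined first two words goes
  -- to the end, and `D` when it is multiplied with the last letter of the third word.
  set B : ℕ → E := fun m => shuffleSum s X (e + m) (p + q + 1 - m) (t + 1) fun j => k (m + j)
  set D : ℕ → E := fun m => shuffleSum s X (e + 1 + m) (p + q + 1 - m) t fun j => k (m + j + 1)
  have step : leftTriple s X e (p + 1) (q + 1) (t + 1) k =
      leftTriple s X e (p + 1) (q + 1) t k +
      shuffleSum s X e (p + 1) (q + 1) (fun m => B m * moveRight s (e + p + q + 1) (t + 1)) +
      shuffleSum s X e (p + 1) (q + 1) (fun m => D m * X (e + p + q + t + 1) *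
        moveRight s (e + p + q + 1) t) := by
    unfold leftTriple
    rw [← shuffleSum_add, ← shuffleSum_add]
    refine shuffleSum_congr fun m h1 h2 => ?_
    rw [show p + 1 + (q + 1) - m = p + q + 1 - m + 1 by omega, shuffleSum_succ,
      show e + m + (p + q + 1 - m) = e + p + q + 1 by omega,
      show e + p + q + 1 + t = e + p + q + t + 1 by omega, mul_assoc,
      show e + m + 1 = e + 1 + m by omega]
    rfl
  have hB1 : shuffleSum s X e (p + 1) q B = leftTriple s X e (p + 1) q (t + 1) k := by
    unfold leftTriple
    refine shuffleSum_congr fun m _ _ => ?_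
    rw [show p + 1 + q - m = p + q + 1 - m by omega]
  have hB2 : shuffleSum s X e p (q + 1) B = leftTriple s X e p (q + 1) (t + 1) k := rfl
  have hB3 : shuffleSum s X (e + 1) p q (fun m => B (m + 1)) =
      leftTriple s X (e + 1) p q (t + 1) (fun m => k (m + 1)) := by
    unfold leftTriple
    refine shuffleSum_congr fun m _ _ => ?_
    simp only [B]
    rw [show p + q + 1 - (m + 1) = p + q - m by omega, show e + (m + 1) = e + 1 + m by omega]
    simp only [add_right_comm]
  have hD1 : shuffleSum s X (e + 1) (p + 1) q D =
      leftTriple s X (e + 1) (p + 1) q t (fun m => k (m + 1)) := by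
    unfold leftTriple
    refine shuffleSum_congr fun m _ _ => ?_
    rw [show p + 1 + q - m = p + q + 1 - m by omega]
  have hD2 : shuffleSum s X (e + 1) p (q + 1) D =
      leftTriple s X (e + 1) p (q + 1) t (fun m => k (m + 1)) := rfl
  have hD3 : shuffleSum s X (e + 1 + 1) p q (fun m => D (m + 1)) =
      leftTriple s X (e + 2) p q t (fun m => k (m + 2)) := by
    unfold leftTriple
    refine shuffleSum_congr fun m _ _ => ?_
    simp only [D]
    rw [show p + q + 1 - (m + 1) = p + q - m by omega, show e + 1 + (m + 1) = e + 2 + m by omega]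
    congr 1
    ext j
    congr 1
    omega
  -- After one step of the inner recursion the words still to be shuffled end at `e + p + q`, so the
  -- outer operators act behind them and can be pulled out.
  rw [step, shuffleSum_succ (k := fun m => B m * _), shuffleSum_succ (k := fun m => D m * _ * _),
    H.shuffleSum_mul_moveRight B (by omega) (by omega),
    H.shuffleSum_mul_moveRight B (by omega) (by omega),
    H.shuffleSum_mul_moveRight (fun m => B (m + 1)) (by omega) (by omega),
    H.shuffleSum_mul_moveRight (fun m => D m * _) (by omega) (by omega),
    H.shuffleSum_mul_moveRight (fun m => D m * _) (by omega) (by omega),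
    H.shuffleSum_mul_moveRight (fun m => D (m + 1) * _) (by omega) (by omega),
    H.shuffleSum_mul_X D (by omega) (by omega), H.shuffleSum_mul_X D (by omega) (by omega),
    H.shuffleSum_mul_X (fun m => D (m + 1)) (by omega) (by omega),
    hB1, hB2, hB3, hD1, hD2, hD3, hC1, hC2]
  noncomm_ring

/-- Here the last letter of the first word has to cross a quasi-shuffle of the other two. This is
where `shuffleSum_mul_moveRight_left` enters; two of the resulting operators then need rewriting to
agree with those of `leftTriple_succ`. -/
lemma rightTriple_succ (e p q t : ℕ) (k : ℕ → E) (h : e + p + q + t + 3 ≤ n) :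
    rightTriple s X e (p + 1) (q + 1) (t + 1) k =
      rightTriple s X e (p + 1) (q + 1) t k +
      rightTriple s X e (p + 1) q (t + 1) k * moveRight s (e + p + q + 1) (t + 1) +
      rightTriple s X e p (q + 1) (t + 1) k * moveRight s (e + p) (q + t + 2) +
      rightTriple s X (e + 1) p q (t + 1) (fun m => k (m + 1)) *
        (moveRight s (e + p + q + 1) (t + 1) * X (e + p + q) * moveRight s (e + p) q) +
      rightTriple s X (e + 1) (p + 1) q t (fun m => k (m + 1)) *
        (X (e + p + q + t + 1) * moveRight s (e + p + q + 1) t) +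
      rightTriple s X (e + 1) p (q + 1) t (fun m => k (m + 1)) *
        (X (e + p + q + t + 1) * moveRight s (e + p) (q + t + 1)) +
      rightTriple s X (e + 2) p q t (fun m => k (m + 2)) *
        (X (e + p + q + t + 1) * moveRight s (e + p + q + 1) t * X (e + p + q) *
          moveRight s (e + p) q) := by
  -- The outer recursion leaves `A`, `B` or `D` according to whether the last letter comes from the
  -- combined last two words, from the first word, or from both.
  set A : ℕ → E := fun m => shuffleSum s X (e + m) (p + 1) (q + t + 1 - m) fun j => k (m + j)
  set B : ℕ → E := fun m => shuffleSum s X (e + m) p (q + t + 2 - m) fun j => k (m + j)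
  set D : ℕ → E := fun m => shuffleSum s X (e + 1 + m) p (q + t + 1 - m) fun j => k (m + j + 1)
  have step : rightTriple s X e (p + 1) (q + 1) (t + 1) k =
      shuffleSum s X (e + p + 1) (q + 1) (t + 1) A +
      shuffleSum s X (e + p + 1) (q + 1) (t + 1)
        (fun m => B m * moveRight s (e + p + m) (q + 1 + (t + 1) - m)) +
      shuffleSum s X (e + p + 1) (q + 1) (t + 1) (fun m => D m * X (e + p + q + t + 1) *
        moveRight s (e + p + m) (q + t + 1 - m)) := by
    unfold rightTriple
    rw [← shuffleSum_add, ← shuffleSum_add, ← add_assoc]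
    refine shuffleSum_congr fun m h1 h2 => ?_
    rw [show q + 1 + (t + 1) - m = q + t + 1 - m + 1 by omega, shuffleSum_succ,
      show e + m + p + (q + t + 1 - m) = e + p + q + t + 1 by omega, mul_assoc,
      show e + m + 1 = e + 1 + m by omega, show e + m + p = e + p + m by omega]
    simp only [B]
    rw [show q + t + 2 - m = q + t + 1 - m + 1 by omega]
    rfl
  have hA1 : shuffleSum s X (e + p + 1) (q + 1) t A = rightTriple s X e (p + 1) (q + 1) t k := by
    unfold rightTriple
    rw [← add_assoc]
    refine shuffleSum_congr fun m _ _ => ?_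
    rw [show q + 1 + t - m = q + t + 1 - m by omega]
  have hA2 : shuffleSum s X (e + p + 1) q (t + 1) A = rightTriple s X e (p + 1) q (t + 1) k := rfl
  have hA3 : shuffleSum s X (e + p + 1 + 1) q t (fun m => A (m + 1)) =
      rightTriple s X (e + 1) (p + 1) q t (fun m => k (m + 1)) := by
    unfold rightTriple
    rw [show e + 1 + (p + 1) = e + p + 1 + 1 by omega]
    refine shuffleSum_congr fun m _ _ => ?_
    simp only [A]
    rw [show q + t + 1 - (m + 1) = q + t - m by omega, show e + (m + 1) = e + 1 + m by omega]
    simp only [add_right_comm]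
  have hB : shuffleSum s X (e + p) (q + 1) (t + 1) B = rightTriple s X e p (q + 1) (t + 1) k := by
    unfold rightTriple
    refine shuffleSum_congr fun m _ _ => ?_
    rw [show q + 1 + (t + 1) - m = q + t + 2 - m by omega]
  have hD1 : shuffleSum s X (e + p + 1) (q + 1) t D =
      rightTriple s X (e + 1) p (q + 1) t (fun m => k (m + 1)) := by
    unfold rightTriple
    rw [show e + 1 + p = e + p + 1 by omega]
    refine shuffleSum_congr fun m _ _ => ?_
    rw [show q + 1 + t - m = q + t + 1 - m by omega]
  have hD2 : shuffleSum s X (e + p + 1) q (t + 1) D =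
      rightTriple s X (e + 1) p q (t + 1) (fun m => k (m + 1)) := by
    unfold rightTriple
    rw [show e + 1 + p = e + p + 1 by omega]
    rfl
  have hD3 : shuffleSum s X (e + p + 1 + 1) q t (fun m => D (m + 1)) =
      rightTriple s X (e + 2) p q t (fun m => k (m + 2)) := by
    unfold rightTriple
    rw [show e + 2 + p = e + p + 1 + 1 by omega]
    refine shuffleSum_congr fun m _ _ => ?_
    simp only [D]
    rw [show q + t + 1 - (m + 1) = q + t - m by omega, show e + 1 + (m + 1) = e + 2 + m by omega]
    congr 1
    ext j
    congr 1
    omega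
  have hE1 : shuffleSum s X (e + p + 1) (q + 1) t (fun m => D m * X (e + p + q + t + 1) *
      moveRight s (e + p + m) (q + t + 1 - m)) =
      shuffleSum s X (e + p + 1) (q + 1) t D * X (e + p + q + t + 1) *
        moveRight s (e + p) (q + t + 1) := by
    rw [← H.shuffleSum_mul_X D (by omega) (by omega), show q + t + 1 = q + 1 + t by omega,
      ← H.shuffleSum_mul_moveRight_left _ (by omega)]
  have hE2 : shuffleSum s X (e + p + 1) q (t + 1) (fun m => D m * X (e + p + q + t + 1) *
      moveRight s (e + p + m) (q + t + 1 - m)) =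
      shuffleSum s X (e + p + 1) q (t + 1) D * X (e + p + q + t + 1) *
        moveRight s (e + p) (q + t + 1) := by
    rw [← H.shuffleSum_mul_X D (by omega) (by omega), show q + t + 1 = q + (t + 1) by omega,
      ← H.shuffleSum_mul_moveRight_left _ (by omega)]
  have hE3 : shuffleSum s X (e + p + 1 + 1) q t (fun m => D (m + 1) * X (e + p + q + t + 1) *
      moveRight s (e + p + (m + 1)) (q + t + 1 - (m + 1))) =
      shuffleSum s X (e + p + 1 + 1) q t (fun m => D (m + 1)) * X (e + p + q + t + 1) *
        moveRight s (e + p + 1) (q + t) := by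
    rw [← H.shuffleSum_mul_X (fun m => D (m + 1)) (by omega) (by omega),
      ← H.shuffleSum_mul_moveRight_left _ (by omega)]
    refine shuffleSum_congr fun m _ _ => ?_
    rw [show q + t + 1 - (m + 1) = q + t - m by omega,
      show e + p + (m + 1) = e + p + 1 + m by omega]
  -- First and second word: one bracketing forms the product before the third word is passed, the
  -- other one afterwards.
  have hF1 : X (e + p + q + t + 1) * moveRight s (e + p) (q + t + 1) *
      moveRight s (e + p + q + 1) (t + 1) =
      moveRight s (e + p + q + 1) (t + 1) * X (e + p + q) * moveRight s (e + p) q := by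
    rw [H.moveRight_succ_mul_X (by omega), show q + t + 1 = q + (t + 1) by omega, moveRight_add,
      mul_assoc, mul_assoc, mul_assoc, mul_assoc,
      H.moveRight_comm (a := e + p) (l := q) (by omega) (by omega)]
    simp only [add_assoc]
  -- All three last letters are multiplied; this is the only place where `FusionRel.assoc` is used.
  have hF2 : X (e + p + q + t + 1) * moveRight s (e + p + 1) (q + t) *
      (X (e + p + q + t + 1) * moveRight s (e + p + q + 1) t) =
      X (e + p + q + t + 1) * moveRight s (e + p + q + 1) t * X (e + p + q) *
        moveRight s (e + p) q := by
    rw [mul_assoc, ← mul_assoc (moveRight s (e + p + 1) (q + t)),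
      H.moveRight_mul_X (by omega) (by omega), mul_assoc, ← mul_assoc, ← H.assoc _ (by omega),
      mul_assoc (X (e + p + q + t + 1)) (moveRight s (e + p + q + 1) t),
      H.moveRight_succ_mul_X (by omega), moveRight_add]
    simp only [mul_assoc]
    rw [H.moveRight_comm (a := e + p) (l := q) (b := e + p + q + 1) (by omega) (by omega)]
  rw [step, H.shuffleSum_mul_moveRight_left B (by omega), hB, shuffleSum_succ (k := A),
    shuffleSum_succ (k := fun m => D m * X (e + p + q + t + 1) *
      moveRight s (e + p + m) (q + t + 1 - m)), hE1, hE2, hE3, hA1, hA2, hA3, hD1, hD2, hD3,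
    show e + p + 1 + q = e + p + q + 1 by omega,
    show e + p + q + 1 + t = e + p + q + t + 1 by omega, ← hF1, ← hF2,
    show q + 1 + (t + 1) = q + t + 2 by omega]
  noncomm_ring

/-- The quasi-shuffle product is associative. -/
theorem leftTriple_eq_rightTriple (e p q t : ℕ) (k : ℕ → E) (h : e + p + q + t ≤ n) :
    leftTriple s X e p q t k = rightTriple s X e p q t k := by
  induction hN : p + q + t using Nat.strong_induction_on generalizing e p q t k with
  | _ N ih =>
    subst hN
    match p, q, t with
    | 0, q, t => simp [leftTriple, rightTriple]
    | p + 1, 0, t => simp [leftTriple, rightTriple]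
    | p + 1, q + 1, 0 => simp [leftTriple, rightTriple]
    | p + 1, q + 1, t + 1 =>
      rw [H.leftTriple_succ _ _ _ _ _ (by omega), H.rightTriple_succ _ _ _ _ _ (by omega),
        ih _ (by omega) _ _ _ _ _ (by omega) rfl, ih _ (by omega) _ _ _ _ _ (by omega) rfl,
        ih _ (by omega) _ _ _ _ _ (by omega) rfl, ih _ (by omega) _ _ _ _ _ (by omega) rfl,
        ih _ (by omega) _ _ _ _ _ (by omega) rfl, ih _ (by omega) _ _ _ _ _ (by omega) rfl,
        ih _ (by omega) _ _ _ _ _ (by omega) rfl]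

end FusionRel

end Triple

/-! ### Iterated quasi-shuffle products along a bracketing. -/

section Brackets

variable {E : Type*} [Ring E] {n : ℕ} {s X : ℕ → E}

/-- The iterated quasi-shuffle product of words of the lengths given by a bracketing, the first
letter being at position `r`. -/
def Bracketing.quasiSum (s X : ℕ → E) : Bracketing → ℕ → (ℕ → E) → E
  | leaf _, _, k => k 0
  -- Units created in the left part do not move the right part. Units created in the right part do
  -- move the left one, so the remaining letters begin at `r + l + m`.
  | node L R, r, k => L.quasiSum s X r fun l => R.quasiSum s X (r + L.size) fun m =>
      shuffleSum s X (r + l + m) (L.size - l) (R.size - m) fun j => k (l + m + j)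

/-- At least one letter survives, so fewer than `T.size` units are created. -/
lemma Bracketing.quasiSum_congr {T : Bracketing} {r : ℕ} {k k' : ℕ → E}
    (h : ∀ m < T.size, k m = k' m) : T.quasiSum s X r k = T.quasiSum s X r k' := by
  induction T generalizing r k k' with
  | leaf c => exact h 0 c.pos
  | node L R hL hR =>
    refine hL fun l hl => hR fun m hm => shuffleSum_congr fun j h1 h2 => h _ ?_
    simp only [size]
    omega

lemma Bracketing.quasiSum_add (T : Bracketing) (r : ℕ) (k k' : ℕ → E) :
    T.quasiSum s X r (fun m => k m + k' m) = T.quasiSum s X r k + T.quasiSum s X r k' := by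
  induction T generalizing r k k' with
  | leaf c => rfl
  | node L R hL hR => simp only [quasiSum, shuffleSum_add, hL, hR]

/-- A family of operators on `w` adjacent positions, compatible with the insertion of a unit on the
left of these positions. -/
structure IsLocalFamily (n : ℕ) (s X : ℕ → E) (w : ℕ) (Y : ℕ → E) : Prop where
  shift : ∀ i j, i + w ≤ j → j + 1 < n → Y (i + 1) * X j = X j * Y i
  comm : ∀ i j, i + w ≤ j → j + 1 < n → s j * Y i = Y i * s j

namespace IsLocalFamily

variable {w : ℕ} {Y : ℕ → E} (hY : IsLocalFamily n s X w Y)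
include hY

/-- Each of the `m` products formed behind the positions of `Y i` pushes these positions to the
right by one. -/
lemma shuffleSum_mul {e p q i : ℕ} (k : ℕ → E) (h : i + w ≤ e) (hn : e + p + q ≤ n) :
    shuffleSum s X e p q (fun m => k m * Y (i + m)) = shuffleSum s X e p q k * Y i := by
  induction p generalizing e q i k with
  | zero => simp
  | succ p ihp =>
    induction q generalizing e i k with
    | zero => simp
    | succ q ihq =>
      have hC : ∀ l, l ≤ q + 1 → moveRight s (e + p) l * Y i = Y i * moveRight s (e + p) l :=
        fun l hl => moveRight_shift fun j hj => hY.comm _ _ (by omega) (by omega)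
      have h3 : shuffleSum s X (e + 1) p q (fun m => k (m + 1) * Y (i + (m + 1))) =
          shuffleSum s X (e + 1) p q (fun m => k (m + 1)) * Y (i + 1) := by
        rw [← ihp (fun m => k (m + 1)) (by omega) (by omega)]
        simp only [add_left_comm, add_comm]
      rw [shuffleSum_succ, shuffleSum_succ, ihq _ (by omega) (by omega),
        ihp _ (by omega) (by omega), h3, add_mul, add_mul]
      simp only [mul_assoc]
      rw [hC _ le_rfl, hC q (by omega), ← mul_assoc (Y (i + 1)), hY.shift _ _ (by omega) (by omega),
        mul_assoc]

lemma quasiSum_mul {T : Bracketing} {r i : ℕ} (k : ℕ → E) (h : i + w ≤ r) (hn : r + T.size ≤ n) :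
    T.quasiSum s X r (fun m => k m * Y (i + m)) = T.quasiSum s X r k * Y i := by
  induction T generalizing r i k with
  | leaf c => rfl
  | node L R hL hR =>
    simp only [Bracketing.size] at hn
    simp only [Bracketing.quasiSum]
    rw [← hL _ h (by omega)]
    refine Bracketing.quasiSum_congr fun l hl => ?_
    rw [← hR _ (by omega) (by omega)]
    refine Bracketing.quasiSum_congr fun m hm => ?_
    rw [← hY.shuffleSum_mul _ (by omega) (by omega)]
    simp only [add_assoc]

end IsLocalFamily

namespace FusionRel

variable (H : FusionRel n s X)
include H

lemma isLocalFamily_X : IsLocalFamily n s X 2 X :=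
  ⟨H.fuse_far, fun _ _ h hj => H.far _ _ h hj⟩

lemma isLocalFamily_moveRight (l : ℕ) :
    IsLocalFamily n s X (l + 1) (fun a => moveRight s a l) :=
  ⟨fun _ _ h hj => H.moveRight_mul_X (by omega) hj,
    fun _ _ h hj => H.commute_moveRight (by omega) hj⟩

/-- Operations on disjoint ranges of positions may be interchanged, except that the `c` units from
the right range shift the left range to `e + c`. -/
lemma shuffleSum_quasiSum {T : Bracketing} {e p q f : ℕ} (k : ℕ → ℕ → E) (h : e + p + q ≤ f)
    (hn : f + T.size ≤ n) : shuffleSum s X e p q (fun j => T.quasiSum s X f (k j)) =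
      T.quasiSum s X f fun c => shuffleSum s X (e + c) p q fun j => k j c := by
  induction p generalizing e q k with
  | zero => simp
  | succ p ihp =>
    induction q generalizing e k with
    | zero => simp
    | succ q ihq =>
      simp only [shuffleSum_succ]
      rw [ihq _ (by omega), ihp _ (by omega), ihp (fun j => k (j + 1)) (by omega),
        Bracketing.quasiSum_add, Bracketing.quasiSum_add,
        ← (H.isLocalFamily_moveRight (q + 1)).quasiSum_mul _ (by omega) hn, ← mul_assoc,
        ← H.isLocalFamily_X.quasiSum_mul _ (by omega) hn,
        ← (H.isLocalFamily_moveRight q).quasiSum_mul _ (by omega) hn]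
      simp only [add_right_comm, mul_assoc]

/-- Once the evaluation of `C` is exchanged with the shuffle of `A` and `B`, both sides evaluate the
three parts and then multiply three words of `A.size - a`, `B.size - b`, `C.size - c` letters. -/
lemma quasiSum_assoc (A B C : Bracketing) {r : ℕ} (k : ℕ → E)
    (hn : r + A.size + B.size + C.size ≤ n) :
    ((A.node B).node C).quasiSum s X r k = (A.node (B.node C)).quasiSum s X r k := by
  simp only [Bracketing.quasiSum, Bracketing.size]
  refine Bracketing.quasiSum_congr fun a ha => ?_
  refine Bracketing.quasiSum_congr fun b hb => ?_
  rw [H.shuffleSum_quasiSum _ (by omega) (by omega), ← add_assoc r]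
  refine Bracketing.quasiSum_congr fun c hc => ?_
  have := H.leftTriple_eq_rightTriple (r + a + b + c) (A.size - a) (B.size - b) (C.size - c)
    (fun j => k (a + b + c + j)) (by omega)
  unfold leftTriple rightTriple at this
  convert this using 1
  · refine shuffleSum_congr fun m h1 h2 => ?_
    rw [show r + (a + b + m) + c = r + a + b + c + m by omega,
      show A.size + B.size - (a + b + m) = A.size - a + (B.size - b) - m by omega]
    congr 1
    ext j
    congr 1
    omega
  · rw [show r + A.size + b + c = r + a + b + c + (A.size - a) by omega]
    refine shuffleSum_congr fun m h1 h2 => ?_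
    rw [show r + a + (b + c + m) = r + a + b + c + m by omega,
      show B.size + C.size - (b + c + m) = B.size - b + (C.size - c) - m by omega]
    congr 1
    ext j
    congr 1
    omega

end FusionRel

/-! ### Block lengths are determined by the cuts and the size. -/

namespace Bracketing

/-- The lengths of the blocks of a bracketing. -/
def leaves : Bracketing → List ℕ+
  | leaf c => [c]
  | node L R => L.leaves ++ R.leaves

/-- The bracketing from the right of blocks of given lengths. -/
def ofList : List ℕ+ → Bracketing
  -- An arbitrary value: the list of leaves of a bracketing is never empty.
  | [] => leaf 1
  | [c] => leaf c
  | c :: d :: l => node (leaf c) (ofList (d :: l))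

/-- The ends of all but the last of the blocks of given lengths behind the position `r`. -/
def listCuts : List ℕ+ → ℕ → Finset ℕ
  | [], _ => ∅
  | [_], _ => ∅
  | c :: d :: l, r => insert (r + c) (listCuts (d :: l) (r + c))

lemma leaves_ne_nil (T : Bracketing) : T.leaves ≠ [] := by
  induction T <;> simp_all [leaves]

lemma size_eq_sum (T : Bracketing) : T.size = (T.leaves.map fun c : ℕ+ => (c : ℕ)).sum := by
  induction T <;> simp_all [leaves, size]

lemma size_ofList {l : List ℕ+} (hl : l ≠ []) :
    (ofList l).size = (l.map fun c : ℕ+ => (c : ℕ)).sum := by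
  induction l with
  | nil => exact absurd rfl hl
  | cons c l ih => cases l <;> simp_all [ofList, size]

lemma listCuts_append {l l' : List ℕ+} (hl : l ≠ []) (hl' : l' ≠ []) (r : ℕ) :
    listCuts (l ++ l') r = listCuts l r ∪ {r + (l.map fun c : ℕ+ => (c : ℕ)).sum} ∪
      listCuts l' (r + (l.map fun c : ℕ+ => (c : ℕ)).sum) := by
  induction l generalizing r with
  | nil => exact absurd rfl hl
  | cons c l ih =>
    cases l with
    | nil =>
      obtain ⟨d, l', rfl⟩ := List.exists_cons_of_ne_nil hl'
      ext
      simp [listCuts]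
    | cons d l =>
      rw [List.cons_append, List.cons_append, listCuts, ← List.cons_append, ih (by simp), listCuts]
      ext
      simp [add_assoc]

lemma cuts_eq_listCuts (T : Bracketing) (r : ℕ) : T.cuts r = listCuts T.leaves r := by
  induction T generalizing r with
  | leaf c => rfl
  | node L R hL hR =>
    rw [cuts, leaves, listCuts_append L.leaves_ne_nil R.leaves_ne_nil, hL, hR, size_eq_sum]

lemma lt_of_mem_listCuts {l : List ℕ+} {r i : ℕ} (h : i ∈ listCuts l r) : r < i := by
  induction l generalizing r with
  | nil => simp [listCuts] at h
  | cons c l ih =>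
    cases l with
    | nil => simp [listCuts] at h
    | cons d l =>
      have := c.pos
      rcases Finset.mem_insert.1 h with rfl | h
      · omega
      · have := ih h
        omega

/-- Blocks have positive length, so the first cut is the smallest one and gives the first length. No
cut marks the end of the last block; its length comes from the total. -/
lemma eq_of_listCuts_eq {l l' : List ℕ+} {r : ℕ} (hl : l ≠ []) (hl' : l' ≠ [])
    (hs : (l.map fun c : ℕ+ => (c : ℕ)).sum = (l'.map fun c : ℕ+ => (c : ℕ)).sum)
    (h : listCuts l r = listCuts l' r) : l = l' := by
  induction l generalizing l' r with
  | nil => exact absurd rfl hl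
  | cons c l ih =>
    obtain ⟨c', l', rfl⟩ := List.exists_cons_of_ne_nil hl'
    match l, l' with
    | [], [] => simpa using hs
    | [], d' :: l' => exact absurd h.symm (Finset.insert_ne_empty _ _)
    | d :: l, [] => simp [listCuts] at h
    | d :: l, d' :: l' =>
      simp only [listCuts] at h
      have h1 : r + c ∈ insert (r + (c' : ℕ)) (listCuts (d' :: l') (r + c')) := by simp [← h]
      have h2 : r + c' ∈ insert (r + (c : ℕ)) (listCuts (d :: l) (r + c)) := by simp [h]
      have hcc : c = c' := by
        rw [← PNat.coe_inj]
        rcases Finset.mem_insert.1 h1 with h1 | h1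
        · omega
        rcases Finset.mem_insert.1 h2 with h2 | h2
        · omega
        have := lt_of_mem_listCuts h1
        have := lt_of_mem_listCuts h2
        omega
      subst hcc
      have h3 : listCuts (d :: l) (r + c) = listCuts (d' :: l') (r + c) := by
        rw [← Finset.erase_insert (a := r + (c : ℕ)) (s := listCuts (d :: l) (r + c))
          (fun hm => (lt_of_mem_listCuts hm).false), h, Finset.erase_insert
          (fun hm => (lt_of_mem_listCuts hm).false)]
      rw [ih (by simp) (by simp) (by simpa using hs) h3]

lemma leaves_eq_of_cuts_eq {T T' : Bracketing} {r : ℕ} (hs : T.size = T'.size)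
    (h : T.cuts r = T'.cuts r) : T.leaves = T'.leaves := by
  rw [size_eq_sum, size_eq_sum] at hs
  rw [cuts_eq_listCuts, cuts_eq_listCuts] at h
  exact eq_of_listCuts_eq T.leaves_ne_nil T'.leaves_ne_nil hs h

end Bracketing

namespace FusionRel

variable (H : FusionRel n s X)
include H

/-- By associativity the first block of `l` can be split off on the left, which leaves the same
claim for a shorter list. -/
lemma quasiSum_node_ofList {l l' : List ℕ+} (hl : l ≠ []) (hl' : l' ≠ []) {r : ℕ} (k : ℕ → E)
    (hn : r + (Bracketing.ofList l).size + (Bracketing.ofList l').size ≤ n) :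
    ((Bracketing.ofList l).node (Bracketing.ofList l')).quasiSum s X r k =
      (Bracketing.ofList (l ++ l')).quasiSum s X r k := by
  induction l generalizing r k with
  | nil => exact absurd rfl hl
  | cons c l ih =>
    cases l with
    | nil =>
      obtain ⟨d, l', rfl⟩ := List.exists_cons_of_ne_nil hl'
      rfl
    | cons d l =>
      simp only [Bracketing.ofList, Bracketing.size] at hn
      simp only [List.cons_append, Bracketing.ofList]
      rw [H.quasiSum_assoc _ _ _ _ (by simp only [Bracketing.size]; omega)]
      have hs : (Bracketing.ofList (d :: (l ++ l'))).size =
          ((Bracketing.ofList (d :: l)).node (Bracketing.ofList l')).size := by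
        simp [Bracketing.size, Bracketing.size_ofList hl', Bracketing.size_ofList, add_assoc]
      conv_rhs => rw [Bracketing.quasiSum, hs]
      conv_lhs => rw [Bracketing.quasiSum]
      refine Bracketing.quasiSum_congr fun m hm => ?_
      rw [ih (by simp) _ (by simp only [Bracketing.size]; omega)]
      rfl

lemma quasiSum_eq_ofList (T : Bracketing) {r : ℕ} (k : ℕ → E) (hn : r + T.size ≤ n) :
    T.quasiSum s X r k = (Bracketing.ofList T.leaves).quasiSum s X r k := by
  induction T generalizing r k with
  | leaf c => rfl
  | node L R hL hR =>
    simp only [Bracketing.size] at hn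
    have h1 : (Bracketing.ofList L.leaves).size = L.size := by
      rw [Bracketing.size_ofList L.leaves_ne_nil, L.size_eq_sum]
    have h2 : (Bracketing.ofList R.leaves).size = R.size := by
      rw [Bracketing.size_ofList R.leaves_ne_nil, R.size_eq_sum]
    rw [Bracketing.leaves, ← H.quasiSum_node_ofList L.leaves_ne_nil R.leaves_ne_nil _ (by omega),
      Bracketing.quasiSum, Bracketing.quasiSum, h1, h2, ← hL _ (by omega)]
    refine Bracketing.quasiSum_congr fun l hl => ?_
    rw [← hR _ (by omega)]

/-- The iterated quasi-shuffle product does not depend on the bracketing. -/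
theorem quasiSum_eq_of_cuts_eq {T T' : Bracketing} {r : ℕ} (hs : T.size = T'.size)
    (h : T.cuts r = T'.cuts r) (k : ℕ → E) (hn : r + T.size ≤ n) :
    T.quasiSum s X r k = T'.quasiSum s X r k := by
  rw [H.quasiSum_eq_ofList T k hn, H.quasiSum_eq_ofList T' k (hs ▸ hn),
    Bracketing.leaves_eq_of_cuts_eq hs h]

end FusionRel

end Brackets

/-! ### Relations in the generalized virtual braid monoid. -/

section Monoid

variable {n : ℕ}

lemma sig_eq {i : ℕ} (h : 1 ≤ i ∧ i < n) :
    sig n i = PresentedMonoid.of _ (GVBGen.braid ⟨i, h⟩) := dif_pos h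

lemma xi_eq {i : ℕ} (h : 1 ≤ i ∧ i < n) :
    xi n i = PresentedMonoid.of _ (GVBGen.virt ⟨i, h⟩) := dif_pos h

lemma GVBRel.eq {x y : FreeMonoid (GVBGen n)} (h : GVBRel n x y) :
    PresentedMonoid.mk (GVBRel n) x = PresentedMonoid.mk (GVBRel n) y :=
  PresentedMonoid.mk_eq_mk_of_rel h

lemma sig_comm {i j : ℕ} (h : i + 2 ≤ j) (hj : j + 1 < n) :
    sig n (i + 1) * sig n (j + 1) = sig n (j + 1) * sig n (i + 1) := by
  rw [sig_eq ⟨by omega, by omega⟩, sig_eq ⟨by omega, hj⟩]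
  exact (GVBRel.comm_braid_braid _ _ (Or.inl (by simp only; omega))).eq

lemma sig_xi_comm {i j : ℕ} (h : i + 2 ≤ j ∨ j + 2 ≤ i) (hi : i + 1 < n) (hj : j + 1 < n) :
    sig n (i + 1) * xi n (j + 1) = xi n (j + 1) * sig n (i + 1) := by
  rw [sig_eq ⟨by omega, hi⟩, xi_eq ⟨by omega, hj⟩]
  exact (GVBRel.comm_braid_virt _ _ (by simp only; omega)).eq

lemma xi_comm {i j : ℕ} (h : i + 2 ≤ j) (hj : j + 1 < n) :
    xi n (i + 1) * xi n (j + 1) = xi n (j + 1) * xi n (i + 1) := by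
  rw [xi_eq ⟨by omega, by omega⟩, xi_eq ⟨by omega, hj⟩]
  exact (GVBRel.comm_virt_virt _ _ (Or.inl (by simp only; omega))).eq

lemma sig_braid {i : ℕ} (h : i + 2 < n) : sig n (i + 1) * sig n (i + 2) * sig n (i + 1) =
    sig n (i + 2) * sig n (i + 1) * sig n (i + 2) := by
  rw [sig_eq ⟨by omega, by omega⟩, sig_eq (i := i + 2) ⟨by omega, h⟩]
  exact (GVBRel.braid_braid _ _ rfl).eq

lemma xi_sig_sig {i : ℕ} (h : i + 2 < n) : xi n (i + 1) * sig n (i + 2) * sig n (i + 1) =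
    sig n (i + 2) * sig n (i + 1) * xi n (i + 2) := by
  rw [sig_eq (i := i + 1) ⟨by omega, by omega⟩, sig_eq (i := i + 2) ⟨by omega, h⟩,
    xi_eq (i := i + 1) ⟨by omega, by omega⟩, xi_eq (i := i + 2) ⟨by omega, h⟩]
  exact (GVBRel.mixed_left _ _ rfl).eq

lemma xi_sig_sig' {i : ℕ} (h : i + 2 < n) : xi n (i + 2) * sig n (i + 1) * sig n (i + 2) =
    sig n (i + 1) * sig n (i + 2) * xi n (i + 1) := by
  rw [sig_eq (i := i + 1) ⟨by omega, by omega⟩, sig_eq (i := i + 2) ⟨by omega, h⟩,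
    xi_eq (i := i + 1) ⟨by omega, by omega⟩, xi_eq (i := i + 2) ⟨by omega, h⟩]
  exact (GVBRel.mixed_right _ _ rfl).eq

@[simp] lemma sigRun_zero (a : ℕ) : sigRun n a 0 = 1 := rfl

lemma sigRun_succ (a l : ℕ) : sigRun n a (l + 1) = sigRun n a l * sig n (a + l) := by
  simp [sigRun, List.range'_1_concat]

lemma sigRun_succ' (a l : ℕ) : sigRun n a (l + 1) = sig n a * sigRun n (a + 1) l := by
  simp [sigRun, List.range'_succ]

lemma sigRun_one_succ (l : ℕ) : sigRun n 1 (l + 1) = sigRun n 1 l * sig n (l + 1) := by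
  rw [sigRun_succ, add_comm 1 l]

lemma mul_sigRun {y : GVB n} {a b l : ℕ} (h : ∀ j < l, sig n (b + j) * y = y * sig n (a + j)) :
    sigRun n b l * y = y * sigRun n a l := by
  induction l with
  | zero => simp
  | succ l ih =>
    rw [sigRun_succ, sigRun_succ, mul_assoc, h l (by omega), ← mul_assoc,
      ih fun j hj => h j (by omega), mul_assoc]

lemma sigRun_comm {a l : ℕ} {y : GVB n} (h : ∀ j < l, sig n (a + j) * y = y * sig n (a + j)) :
    y * sigRun n a l = sigRun n a l * y := (mul_sigRun h).symm

lemma sig_mul_sigRun_far {j m : ℕ} (h : m + 1 ≤ j) (hj : j + 1 < n) :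
    sig n (j + 1) * sigRun n 1 m = sigRun n 1 m * sig n (j + 1) :=
  sigRun_comm fun i hi => by
    rw [add_comm 1 i]
    exact sig_comm (by omega) hj

lemma xi_mul_sigRun_far {j m : ℕ} (h : m + 1 ≤ j) (hj : j + 1 < n) :
    xi n (j + 1) * sigRun n 1 m = sigRun n 1 m * xi n (j + 1) :=
  sigRun_comm fun i hi => by
    rw [add_comm 1 i]
    exact sig_xi_comm (by omega) (by omega) hj

/-- `σ_1 ⋯ σ_m` carries the letter at position `m + 1` to the front and pushes the others to the
right, and crossings of these are shifted along. The braid relation is needed for `m = i + 2` only;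
later factors commute. -/
lemma sig_mul_sigRun {i m : ℕ} (h : i + 2 ≤ m) (hm : m < n) :
    sig n (i + 2) * sigRun n 1 m = sigRun n 1 m * sig n (i + 1) := by
  induction m, h using Nat.le_induction with
  | base =>
    rw [sigRun_one_succ, sigRun_one_succ, ← mul_assoc, ← mul_assoc,
      sig_mul_sigRun_far (j := i + 1) (by omega) (by omega), mul_assoc, mul_assoc, ← mul_assoc _ _
      (sig n (i + 1 + 1)), ← sig_braid (by omega)]
    simp only [mul_assoc]
  | succ m hm' ih =>
    rw [sigRun_one_succ, ← mul_assoc, ih (by omega), mul_assoc, sig_comm (by omega) (by omega),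
      mul_assoc]

lemma xi_mul_sigRun {i m : ℕ} (h : i + 2 ≤ m) (hm : m < n) :
    xi n (i + 2) * sigRun n 1 m = sigRun n 1 m * xi n (i + 1) := by
  induction m, h using Nat.le_induction with
  | base =>
    rw [sigRun_one_succ, sigRun_one_succ, ← mul_assoc, ← mul_assoc,
      xi_mul_sigRun_far (j := i + 1) (by omega) (by omega), mul_assoc, mul_assoc, ← mul_assoc _ _
      (sig n (i + 1 + 1)), xi_sig_sig' (by omega)]
    simp only [mul_assoc]
  | succ m hm' ih =>
    rw [sigRun_one_succ, ← mul_assoc, ih (by omega), mul_assoc,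
      ← sig_xi_comm (by omega) (by omega) (by omega), mul_assoc]

/-- The element `σ_1 ⋯ σ_i ξ_{i+1}`, which multiplies two letters and moves the unit which arises to
the very left. -/
def fuse (n i : ℕ) : GVB n := sigRun n 1 i * xi n (i + 1)

lemma sig_mul_fuse {i m : ℕ} (h : i + 2 ≤ m) (hm : m + 1 < n) :
    sig n (i + 2) * fuse n m = fuse n m * sig n (i + 1) := by
  rw [fuse, ← mul_assoc, sig_mul_sigRun h (by omega), mul_assoc,
    sig_xi_comm (by omega) (by omega) hm, mul_assoc]

lemma sig_mul_fuse_far {i m : ℕ} (h : m + 2 ≤ i) (hi : i + 1 < n) :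
    sig n (i + 1) * fuse n m = fuse n m * sig n (i + 1) := by
  rw [fuse, ← mul_assoc, sig_mul_sigRun_far (by omega) hi, mul_assoc,
    sig_xi_comm (by omega) hi (by omega), mul_assoc]

/-- A letter passing a product from the left passes both factors. A mixed relation gives this in the
monoid; the mirror image `over_right` is obtained for operators. -/
lemma sig_mul_fuse_succ {m : ℕ} (h : m + 2 < n) :
    sig n (m + 2) * fuse n (m + 1) = fuse n m * sig n (m + 2) * sig n (m + 1) := by
  rw [fuse, fuse, mul_assoc, mul_assoc, ← mul_assoc (xi n _), xi_sig_sig h, sigRun_one_succ,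
    ← mul_assoc, ← mul_assoc, sig_mul_sigRun_far (j := m + 1) (by omega) (by omega)]
  simp only [mul_assoc]

/-- Forming two distant products in either order gives results that differ by `σ_1`, the crossing of
the two units. -/
lemma fuse_mul_fuse {i j : ℕ} (h : i + 2 ≤ j) (hj : j + 1 < n) :
    fuse n (i + 1) * fuse n j = sig n 1 * (fuse n j * fuse n i) := by
  have h1 : sigRun n 2 i * sigRun n 1 j = sigRun n 1 j * sigRun n 1 i := by
    refine mul_sigRun fun k hk => ?_
    rw [add_comm 2 k, add_comm 1 k]
    exact sig_mul_sigRun (by omega) (by omega)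
  calc fuse n (i + 1) * fuse n j
      = sigRun n 1 (i + 1) * (xi n (i + 2) * sigRun n 1 j) * xi n (j + 1) := by
        simp only [fuse, mul_assoc]
    _ = sig n 1 * (sigRun n 2 i * sigRun n 1 j) * (xi n (i + 1) * xi n (j + 1)) := by
        rw [xi_mul_sigRun h (by omega), sigRun_succ']
        simp only [mul_assoc]
    _ = sig n 1 * (sigRun n 1 j * (sigRun n 1 i * xi n (j + 1)) * xi n (i + 1)) := by
        rw [h1, xi_comm h hj]
        simp only [mul_assoc]
    _ = _ := by
        rw [← xi_mul_sigRun_far (by omega) hj]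
        simp only [fuse, mul_assoc]

end Monoid

/-! ### The relations for operators of a unital braided algebra. -/

section Operators

variable {K W : Type*} [Field K] [Ring W] [Algebra K W] {br : W ⊗[K] W →ₗ[K] W ⊗[K] W}
  (h : IsBraidedAlgebra br) {n : ℕ}

lemma rep_sig {i : ℕ} (hi : 1 ≤ i ∧ i < n) :
    rep h n (MonoidAlgebra.of K (GVB n) (sig n i)) = localOp br ⟨i, hi⟩ := by
  rw [sig_eq hi, rep, MonoidAlgebra.lift_of]
  rfl

lemma rep_xi {i : ℕ} (hi : 1 ≤ i ∧ i < n) :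
    rep h n (MonoidAlgebra.of K (GVB n) (xi n i)) = localOp (unitMul K W) ⟨i, hi⟩ := by
  rw [xi_eq hi, rep, MonoidAlgebra.lift_of]
  rfl

/-- The operators by which the elements of `GVB_n⁺` act. -/
noncomputable def repHom (n : ℕ) : GVB n →* Module.End K (⨂[K]^n W) :=
  (rep h n : MonoidAlgebra K (GVB n) →* _).comp (MonoidAlgebra.of K (GVB n))

lemma rep_of (g : GVB n) : rep h n (MonoidAlgebra.of K (GVB n) g) = repHom h n g := rfl

lemma repHom_sig_tprod {i : ℕ} (hi : i + 1 < n) (v : Fin n → W) :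
    repHom h n (sig n (i + 1)) (PiTensorProduct.tprod K v) =
      place2 K (a := ⟨i, by omega⟩) (b := ⟨i + 1, hi⟩) (by simp) v
        (br (v ⟨i, by omega⟩ ⊗ₜ v ⟨i + 1, hi⟩)) := by
  rw [← rep_of, rep_sig h ⟨by omega, hi⟩]
  exact opAt_tprod _ _ _

lemma repHom_xi_tprod {i : ℕ} (hi : i + 1 < n) (v : Fin n → W) :
    repHom h n (xi n (i + 1)) (PiTensorProduct.tprod K v) =
      PiTensorProduct.tprod K (Function.update (Function.update v ⟨i, by omega⟩ 1) ⟨i + 1, hi⟩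
        (v ⟨i, by omega⟩ * v ⟨i + 1, hi⟩)) := by
  rw [← rep_of, rep_xi h ⟨by omega, hi⟩, ← place2_tmul (by simp)]
  exact opAt_tprod _ _ _

/-- A unit is exchanged with its neighbour as by a flip, so a pure tensor stays pure while the unit
travels to the front. -/
lemma repHom_sigRun_tprod {l : ℕ} (hl : l < n) (v : Fin n → W) (hv : v ⟨l, hl⟩ = 1) :
    ∃ v' : Fin n → W, repHom h n (sigRun n 1 l) (PiTensorProduct.tprod K v) =
      PiTensorProduct.tprod K v' ∧ v' ⟨0, by omega⟩ = 1 ∧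
      (∀ i (hi : i < l), v' ⟨i + 1, by omega⟩ = v ⟨i, by omega⟩) ∧
      ∀ j : Fin n, l < j → v' j = v j := by
  induction l generalizing v with
  | zero => exact ⟨v, by simp, hv, by simp, fun _ _ => rfl⟩
  | succ l ih =>
    obtain ⟨v', h1, h2, h3, h4⟩ := ih (by omega) (Function.update (Function.update v
      ⟨l, by omega⟩ 1) ⟨l + 1, hl⟩ (v ⟨l, by omega⟩)) (by simp)
    refine ⟨v', ?_, h2, fun i hi => ?_, fun j hj => ?_⟩
    · rw [sigRun_one_succ, map_mul, Module.End.mul_apply, repHom_sig_tprod h hl, hv, h.one_right,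
        place2_tmul, h1]
    · rcases Nat.lt_succ_iff_lt_or_eq.1 hi with hi | rfl
      · rw [h3 i hi, Function.update_of_ne (by simp; omega), Function.update_of_ne (by simp; omega)]
      · rw [h4 _ (by simp)]
        simp
    · rw [h4 _ (by omega), Function.update_of_ne (by rintro rfl; simp at hj),
        Function.update_of_ne (by rintro rfl; simp at hj)]

/-- The old first letter becomes the second one if `0 < l`; hence a second product, formed further
right, leaves units at the first two positions. -/
lemma repHom_fuse_tprod {l : ℕ} (hl : l + 1 < n) (v : Fin n → W) :
    ∃ v' : Fin n → W, repHom h n (fuse n l) (PiTensorProduct.tprod K v) =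
      PiTensorProduct.tprod K v' ∧ v' ⟨0, by omega⟩ = 1 ∧
      (0 < l → v' ⟨1, by omega⟩ = v ⟨0, by omega⟩) := by
  obtain ⟨v', h1, h2, h3, -⟩ := repHom_sigRun_tprod h (l := l) (by omega) (Function.update
    (Function.update v ⟨l, by omega⟩ 1) ⟨l + 1, hl⟩ (v ⟨l, by omega⟩ * v ⟨l + 1, hl⟩)) (by simp)
  refine ⟨v', ?_, h2, fun h0 => ?_⟩
  · rw [fuse, map_mul, Module.End.mul_apply, repHom_xi_tprod h hl, h1]
  · rw [h3 0 h0, Function.update_of_ne (by simp), Function.update_of_ne (by simp; omega)]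

lemma repHom_sig_mul_fuse_mul_fuse {i j : ℕ} (hij : i < j) (hj : j + 1 < n) :
    repHom h n (sig n 1 * (fuse n j * fuse n i)) = repHom h n (fuse n j * fuse n i) := by
  refine PiTensorProduct.ext (MultilinearMap.ext fun v => ?_)
  obtain ⟨v', h1, h2, -⟩ := repHom_fuse_tprod h (l := i) (by omega) v
  obtain ⟨w, h3, h4, h5⟩ := repHom_fuse_tprod h hj v'
  simp only [LinearMap.compMultilinearMap_apply, map_mul, Module.End.mul_apply, h1, h3]
  have h6 := h5 (by omega)
  rw [h2] at h6
  rw [repHom_sig_tprod h (i := 0) (by omega)]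
  simp only [zero_add, h4, h6, h.one_left, place2_tmul]
  congr 1
  rw [Function.update_eq_self_iff.2, Function.update_eq_self_iff.2 h4.symm]
  simp [h6]

/-- Put three elements of `W` at the positions `m`, `m + 1`, `m + 2` of a pure tensor. -/
noncomputable def tripleAt (K : Type*) {W : Type*} [Field K] [Ring W] [Algebra K W] {n m : ℕ}
    (hm : m + 2 < n) (v : Fin n → W) : (W ⊗[K] W) ⊗[K] W →ₗ[K] ⨂[K]^n W :=
  place3 K (a := ⟨m, by omega⟩) (b := ⟨m + 1, by omega⟩) (c := ⟨m + 2, hm⟩) (by simp) (by simp)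
    (by simp) v

lemma tripleAt_ext {m : ℕ} (hm : m + 2 < n) {f g : Module.End K (⨂[K]^n W)}
    (hfg : ∀ v u, f (tripleAt K hm v u) = g (tripleAt K hm v u)) : f = g := by
  refine PiTensorProduct.ext (MultilinearMap.ext fun v => ?_)
  simp only [LinearMap.compMultilinearMap_apply]
  rw [tprod_eq_place3 (K := K) (a := ⟨m, by omega⟩) (b := ⟨m + 1, by omega⟩) (c := ⟨m + 2, hm⟩)
    (by simp) (by simp) (by simp) v]
  exact hfg _ _

variable {m : ℕ} (hm : m + 2 < n) (v : Fin n → W) (u : (W ⊗[K] W) ⊗[K] W)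

lemma repHom_sig_tripleAt : repHom h n (sig n (m + 1)) (tripleAt K hm v u) =
    tripleAt K hm v (on12 br u) := by
  rw [← rep_of, rep_sig h ⟨by omega, by omega⟩]
  exact opAt_place3_left _ _ _ _ _ _

lemma repHom_sig_succ_tripleAt : repHom h n (sig n (m + 2)) (tripleAt K hm v u) =
    tripleAt K hm v (on23 br u) := by
  rw [← rep_of, rep_sig h ⟨by omega, by omega⟩]
  exact opAt_place3_right _ _ _ _ _ _

lemma repHom_xi_tripleAt : repHom h n (xi n (m + 1)) (tripleAt K hm v u) =
    tripleAt K hm v (on12 (unitMul K W) u) := by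
  rw [← rep_of, rep_xi h ⟨by omega, by omega⟩]
  exact opAt_place3_left _ _ _ _ _ _

lemma repHom_xi_succ_tripleAt : repHom h n (xi n (m + 2)) (tripleAt K hm v u) =
    tripleAt K hm v (on23 (unitMul K W) u) := by
  rw [← rep_of, rep_xi h ⟨by omega, by omega⟩]
  exact opAt_place3_right _ _ _ _ _ _

-- After `ξ_{m+1}` there is a unit at its first position, which `σ_{m+2}` does not touch, and the
-- square of the braiding fixes `1 ⊗ x`.
include hm in
lemma repHom_sig_sig_sig_xi : repHom h n (sig n (m + 1) * sig n (m + 1) * sig n (m + 2) *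
    xi n (m + 1)) = repHom h n (sig n (m + 2) * xi n (m + 1)) := by
  refine tripleAt_ext hm fun v u => ?_
  simp only [map_mul, Module.End.mul_apply, repHom_sig_tripleAt, repHom_sig_succ_tripleAt,
    repHom_xi_tripleAt]
  congr 1
  rw [on12_unitMul, on23_assoc]
  generalize br _ = w
  induction w using TensorProduct.induction_on with
  | zero => simp
  | add a b ha hb => simp only [TensorProduct.tmul_add, map_add, ha, hb]
  | tmul x y => simp [h.one_left, h.one_right]

-- Both sides send `x ⊗ y ⊗ z` to `1 ⊗ 1 ⊗ xyz`.
include hm in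
lemma repHom_xi_sig_xi : repHom h n (xi n (m + 2) * sig n (m + 1) * xi n (m + 2)) =
    repHom h n (xi n (m + 2) * xi n (m + 1)) := by
  refine tripleAt_ext hm fun v u => ?_
  simp only [map_mul, Module.End.mul_apply, repHom_sig_tripleAt, repHom_xi_succ_tripleAt,
    repHom_xi_tripleAt]
  congr 1
  induction u using TensorProduct.induction_on with
  | zero => simp
  | add a b ha hb => simp only [map_add, ha, hb]
  | tmul s z =>
    induction s using TensorProduct.induction_on with
    | zero => simp
    | add a b ha hb => simp only [TensorProduct.add_tmul, map_add, ha, hb]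
    | tmul x y => simp [h.one_right, mul_assoc]

/-- The operators of a unital braided algebra satisfy the relations for quasi-shuffle products. -/
theorem fusionRel_repHom (n : ℕ) :
    FusionRel n (fun i => repHom h n (sig n (i + 1))) (fun i => repHom h n (fuse n i)) where
  comm i j hij hj := by simp only [← map_mul, sig_comm hij hj]
  braid i hi := by simp only [← map_mul, sig_braid hi]
  shift i m hi hm := by simp only [← map_mul, sig_mul_fuse hi hm]
  far i m hi hm := by simp only [← map_mul, sig_mul_fuse_far hi hm]
  over_right m hm := by
    -- The mixed relation moves `ξ` to the right end and leaves a superfluous `σ_{m+1} σ_{m+1}`,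
    -- which acts trivially on the unit.
    have h1 : fuse n (m + 1) * sig n (m + 1) * sig n (m + 2) =
        sigRun n 1 m * (sig n (m + 1) * sig n (m + 1) * sig n (m + 2) * xi n (m + 1)) := by
      simp only [fuse, sigRun_one_succ, mul_assoc]
      rw [← mul_assoc (xi n _), xi_sig_sig' hm]
      simp only [mul_assoc]
    have h2 : sig n (m + 2) * fuse n m = sigRun n 1 m * (sig n (m + 2) * xi n (m + 1)) := by
      rw [fuse, ← mul_assoc, sig_mul_sigRun_far (by omega) (by omega), mul_assoc]
    rw [← map_mul, ← map_mul, ← map_mul, h1, h2, map_mul, ← repHom_sig_sig_sig_xi h hm, map_mul _ (sigRun n 1 m)]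
  over_left m hm := by simp only [← map_mul, sig_mul_fuse_succ hm]
  assoc m hm := by
    have h1 : fuse n (m + 1) * fuse n (m + 1) = sigRun n 1 (m + 1) * sigRun n 1 m *
        (xi n (m + 2) * sig n (m + 1) * xi n (m + 2)) := by
      simp only [fuse, mul_assoc]
      rw [sigRun_one_succ, ← mul_assoc (sigRun n 1 m) (xi n _),
        ← xi_mul_sigRun_far (by omega) (by omega)]
      simp only [mul_assoc]
    have h2 : fuse n (m + 1) * fuse n m = sigRun n 1 (m + 1) * sigRun n 1 m *
        (xi n (m + 2) * xi n (m + 1)) := by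
      simp only [fuse, mul_assoc]
      rw [← mul_assoc (xi n _) (sigRun n 1 m), xi_mul_sigRun_far (by omega) (by omega)]
      simp only [mul_assoc]
    rw [← map_mul, ← map_mul, h1, h2, map_mul, ← repHom_xi_sig_xi h hm,
      map_mul _ (sigRun n 1 (m + 1) * sigRun n 1 m)]
  fuse_far i j hi hj := by
    rw [← map_mul, ← map_mul, fuse_mul_fuse hi hj,
      repHom_sig_mul_fuse_mul_fuse h (by omega) hj]

end Operators

/-! ### Shuffles, their last letters and their bubble decompositions. -/

section Shuffles

variable {n : ℕ}

lemma IsShuffle.mem_block {r p q : ℕ} {σ : Equiv.Perm (Fin n)} (h : IsShuffle r p q σ) {a : Fin n}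
    (h1 : r ≤ a.1) (h2 : a.1 < r + p + q) : r ≤ (σ a).1 ∧ (σ a).1 < r + p + q := by
  by_contra hc
  have := σ.injective (h.1 (σ a) (by omega))
  rw [this] at hc
  exact hc ⟨h1, h2⟩

/-- Fixed letters may be added at both outer ends, as long as the border between the two parts stays
where it is. -/
lemma IsShuffle.mono {r p q r' p' q' : ℕ} {σ : Equiv.Perm (Fin n)} (h : IsShuffle r' p' q' σ)
    (h1 : r ≤ r') (h2 : r' + p' = r + p) (h3 : r' + p' + q' ≤ r + p + q) : IsShuffle r p q σ := by
  refine ⟨fun a ha => h.1 a (by omega), fun a b ha hab hb => ?_, fun a b ha hab hb => ?_⟩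
  · by_cases har : r' ≤ a.1
    · exact h.2.1 a b har hab (by omega)
    rw [h.1 a (by omega)]
    by_cases hbr : r' ≤ b.1
    · have := h.mem_block hbr (by omega)
      rw [Fin.lt_def]
      omega
    · rwa [h.1 b (by omega)]
  · by_cases hb' : b.1 < r' + p' + q'
    · exact h.2.2 a b (by omega) hab hb'
    rw [h.1 b (by omega)]
    by_cases ha' : a.1 < r' + p' + q'
    · have := h.mem_block (a := a) (by omega) ha'
      rw [Fin.lt_def]
      omega
    · rwa [h.1 a (by omega)]

open Classical in
/-- The set `𝔖_{p,q}^{↑r}`. -/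
noncomputable def shuffles (n r p q : ℕ) : Finset (Equiv.Perm (Fin n)) :=
  Finset.univ.filter (IsShuffle r p q)

@[simp] lemma mem_shuffles {r p q : ℕ} {σ : Equiv.Perm (Fin n)} :
    σ ∈ shuffles n r p q ↔ IsShuffle r p q σ := by simp [shuffles]

lemma isShuffle_zero {r p q : ℕ} (h : p = 0 ∨ q = 0) {σ : Equiv.Perm (Fin n)} :
    IsShuffle r p q σ ↔ σ = 1 := by
  refine ⟨fun hσ => ?_, ?_⟩
  · have hm : StrictMono σ := by
      intro a b hab
      by_cases ha : r ≤ a.1 ∧ a.1 < r + p + q <;> by_cases hb : r ≤ b.1 ∧ b.1 < r + p + q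
      · rcases h with rfl | rfl
        · exact hσ.2.2 a b (by omega) hab (by omega)
        · exact hσ.2.1 a b (by omega) hab (by omega)
      · have := hσ.mem_block ha.1 ha.2
        rw [hσ.1 b (by omega), Fin.lt_def]
        omega
      · have := hσ.mem_block hb.1 hb.2
        rw [hσ.1 a (by omega), Fin.lt_def]
        omega
      · rwa [hσ.1 a (by omega), hσ.1 b (by omega)]
    -- An order automorphism of the finite chain `Fin n` is the identity.
    ext a
    exact congrArg Fin.val (congrFun (Subsingleton.elim
      (StrictMono.orderIsoOfSurjective σ hm σ.surjective) (OrderIso.refl _) ▸ rfl :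
      (fun x => StrictMono.orderIsoOfSurjective σ hm σ.surjective x) = fun x => x) a)
  · rintro rfl
    exact ⟨fun _ _ => rfl, fun _ _ _ h _ => h, fun _ _ _ h _ => h⟩

lemma shuffles_zero {r p q : ℕ} (h : p = 0 ∨ q = 0) : shuffles n r p q = {1} := by
  ext σ
  simp [isShuffle_zero h]

/-- The cycle which moves the letter at position `x` to the position `y`, where `x ≤ y`. -/
def moveCycle {x y : ℕ} (hxy : x ≤ y) (hy : y < n) : Equiv.Perm (Fin n) where
  toFun k := ⟨if k.1 = x then y else if x < k.1 ∧ k.1 ≤ y then k.1 - 1 else k.1, by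
    have := k.2
    split_ifs <;> omega⟩
  invFun k := ⟨if k.1 = y then x else if x ≤ k.1 ∧ k.1 < y then k.1 + 1 else k.1, by
    have := k.2
    split_ifs <;> omega⟩
  left_inv k := by
    ext
    simp only
    split_ifs <;> omega
  right_inv k := by
    ext
    simp only
    split_ifs <;> omega

section moveCycle

variable {x y : ℕ} (hxy : x ≤ y) (hy : y < n)

lemma moveCycle_left : moveCycle hxy hy ⟨x, by omega⟩ = ⟨y, hy⟩ := by
  ext
  simp [moveCycle]

lemma moveCycle_succ {k : ℕ} (h1 : x ≤ k) (h2 : k < y) :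
    moveCycle hxy hy ⟨k + 1, by omega⟩ = ⟨k, by omega⟩ := by
  ext
  simp only [moveCycle, Equiv.coe_fn_mk]
  split_ifs <;> omega

lemma moveCycle_of_lt {k : Fin n} (h : k.1 < x) : moveCycle hxy hy k = k := by
  ext
  simp only [moveCycle, Equiv.coe_fn_mk]
  split_ifs <;> omega

lemma moveCycle_of_gt {k : Fin n} (h : y < k.1) : moveCycle hxy hy k = k := by
  ext
  simp only [moveCycle, Equiv.coe_fn_mk]
  split_ifs <;> omega

end moveCycle

lemma IsShuffle.mul_moveCycle {r p q : ℕ} {σ : Equiv.Perm (Fin n)} (h : IsShuffle r p (q + 1) σ)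
    (hn : r + p + q + 1 < n) : IsShuffle r (p + 1) (q + 1)
      (σ * moveCycle (show r + p ≤ r + p + q + 1 by omega) hn) := by
  refine ⟨fun a ha => ?_, fun a b ha hab hb => ?_, fun a b ha hab hb => ?_⟩
  · rw [Equiv.Perm.mul_apply]
    rcases ha with ha | ha
    · rw [moveCycle_of_lt _ _ (by omega), h.1 a (by omega)]
    · rw [moveCycle_of_gt _ _ (by omega), h.1 a (by omega)]
  · rw [Fin.lt_def] at hab
    rw [Equiv.Perm.mul_apply, Equiv.Perm.mul_apply, moveCycle_of_lt _ _ (by omega)]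
    by_cases hbx : b.1 < r + p
    · rw [moveCycle_of_lt _ _ hbx]
      exact h.2.1 a b ha hab hbx
    · have hrp : r + p < n := by omega
      obtain rfl : b = ⟨r + p, hrp⟩ := Fin.ext (by simp only; omega)
      have := h.mem_block ha (by omega)
      rw [moveCycle_left, h.1 ⟨r + p + q + 1, hn⟩ (by simp only; omega), Fin.lt_def]
      simp only
      omega
  · rw [Fin.lt_def] at hab
    obtain ⟨a, ha'⟩ := a
    obtain ⟨b, hb'⟩ := b
    simp only at ha hab hb
    obtain ⟨a, rfl⟩ := Nat.exists_eq_succ_of_ne_zero (show a ≠ 0 by omega)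
    obtain ⟨b, rfl⟩ := Nat.exists_eq_succ_of_ne_zero (show b ≠ 0 by omega)
    rw [Equiv.Perm.mul_apply, Equiv.Perm.mul_apply, moveCycle_succ _ _ (by omega) (by omega),
      moveCycle_succ _ _ (by omega) (by omega)]
    exact h.2.2 _ _ (by simp only; omega) (by simp only [Fin.mk_lt_mk]; omega)
      (by simp only; omega)

/-- The order within each part is kept, so only the last letter of a part can reach the end of the
block. -/
lemma IsShuffle.apply_last {r p q : ℕ} {σ : Equiv.Perm (Fin n)} (h : IsShuffle r (p + 1) (q + 1) σ)
    (hn : r + p + q + 1 < n) : σ ⟨r + p + q + 1, hn⟩ = ⟨r + p + q + 1, hn⟩ ∨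
      σ ⟨r + p, by omega⟩ = ⟨r + p + q + 1, hn⟩ := by
  obtain ⟨c, hc⟩ := σ.surjective ⟨r + p + q + 1, hn⟩
  have hc' : (σ c).1 = r + p + q + 1 := by rw [hc]
  have hcb : r ≤ c.1 ∧ c.1 < r + (p + 1) + (q + 1) := by
    by_contra hcb
    rw [h.1 c (by omega)] at hc'
    omega
  by_cases hcx : c.1 < r + p + 1
  · right
    by_cases hcx' : c.1 = r + p
    · rw [← hc]
      exact congrArg σ (Fin.ext hcx'.symm)
    have h1 := h.2.1 c ⟨r + p, by omega⟩ hcb.1 (by rw [Fin.lt_def]; simp only; omega)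
      (by simp only; omega)
    have h2 := h.mem_block (a := ⟨r + p, by omega⟩) (by simp only; omega) (by simp only; omega)
    rw [Fin.lt_def] at h1
    omega
  · left
    by_cases hcx' : c.1 = r + p + q + 1
    · nth_rewrite 2 [← hc]
      exact congrArg σ (Fin.ext hcx'.symm)
    have h1 := h.2.2 c ⟨r + p + q + 1, by omega⟩ (by omega) (by rw [Fin.lt_def]; simp only; omega)
      (by simp only; omega)
    have h2 := h.mem_block (a := ⟨r + p + q + 1, by omega⟩) (by simp only; omega)
      (by simp only; omega)
    rw [Fin.lt_def] at h1
    omega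

lemma IsShuffle.of_apply_last {r p q : ℕ} {σ : Equiv.Perm (Fin n)} (h : IsShuffle r p (q + 1) σ)
    (hn : r + p + q < n) (hσ : σ ⟨r + p + q, hn⟩ = ⟨r + p + q, hn⟩) : IsShuffle r p q σ := by
  refine ⟨fun a ha => ?_, h.2.1, fun a b ha hab hb => h.2.2 a b ha hab (by omega)⟩
  by_cases hax : a.1 = r + p + q
  · obtain rfl : a = ⟨r + p + q, hn⟩ := Fin.ext hax
    exact hσ
  · exact h.1 a (by omega)

lemma IsShuffle.of_mul_moveCycle {r p q : ℕ} {σ : Equiv.Perm (Fin n)} (hn : r + p + q + 1 < n)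
    (h : IsShuffle r (p + 1) (q + 1)
      (σ * moveCycle (show r + p ≤ r + p + q + 1 by omega) hn))
    (hσ : σ ⟨r + p + q + 1, hn⟩ = ⟨r + p + q + 1, hn⟩) : IsShuffle r p (q + 1) σ := by
  refine ⟨fun a ha => ?_, fun a b ha hab hb => ?_, fun a b ha hab hb => ?_⟩
  · by_cases hax : a.1 = r + p + q + 1
    · obtain rfl : a = ⟨r + p + q + 1, hn⟩ := Fin.ext hax
      exact hσ
    · have := h.1 a (by omega)
      rw [Equiv.Perm.mul_apply] at this
      rcases ha with ha | ha
      · rwa [moveCycle_of_lt _ _ (by omega)] at this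
      · rwa [moveCycle_of_gt _ _ (by omega)] at this
  · rw [Fin.lt_def] at hab
    have := h.2.1 a b ha hab (by omega)
    rwa [Equiv.Perm.mul_apply, Equiv.Perm.mul_apply, moveCycle_of_lt _ _ (by omega),
      moveCycle_of_lt _ _ (by omega)] at this
  · rw [Fin.lt_def] at hab
    have := h.2.2 ⟨a.1 + 1, by omega⟩ ⟨b.1 + 1, by omega⟩ (by simp only; omega)
      (by simp only [Fin.mk_lt_mk]; omega) (by simp only; omega)
    rwa [Equiv.Perm.mul_apply, Equiv.Perm.mul_apply, moveCycle_succ _ _ (by omega) (by omega),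
      moveCycle_succ _ _ (by omega) (by omega)] at this

/-- Every shuffle either fixes the last letter of its block, or it moves the last letter of the
left part to the end of the block. -/
lemma sum_shuffles_succ {M : Type*} [AddCommMonoid M] (F : Equiv.Perm (Fin n) → M) {r p q : ℕ}
    (hn : r + p + q + 1 < n) : ∑ σ ∈ shuffles n r (p + 1) (q + 1), F σ =
      ∑ σ ∈ shuffles n r (p + 1) q, F σ + ∑ σ ∈ shuffles n r p (q + 1),
        F (σ * moveCycle (show r + p ≤ r + p + q + 1 by omega) hn) := by
  classical
  set c := moveCycle (show r + p ≤ r + p + q + 1 by omega) hn with hc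
  have hU : shuffles n r (p + 1) (q + 1) = shuffles n r (p + 1) q ∪
      (shuffles n r p (q + 1)).map (Equiv.mulRight c).toEmbedding := by
    ext σ
    simp only [mem_shuffles, Finset.mem_union, Finset.mem_map, Equiv.coe_toEmbedding,
      Equiv.coe_mulRight]
    constructor
    · intro h
      rcases h.apply_last hn with hl | hl
      · left
        have he : r + (p + 1) + q = r + p + q + 1 := by omega
        exact h.of_apply_last (by omega) (by simpa only [he] using hl)
      · right
        refine ⟨σ * c⁻¹, IsShuffle.of_mul_moveCycle hn ?_ ?_, by simp⟩
        · rwa [← hc, inv_mul_cancel_right]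
        · rw [Equiv.Perm.mul_apply, show c⁻¹ ⟨r + p + q + 1, hn⟩ = ⟨r + p, by omega⟩ by
            rw [Equiv.Perm.inv_eq_iff_eq, hc, moveCycle_left], hl]
    · rintro (h | ⟨τ, h, rfl⟩)
      · exact h.mono le_rfl rfl (by omega)
      · exact h.mul_moveCycle hn
  rw [hU, Finset.sum_union, Finset.sum_map]
  · rfl
  · rw [Finset.disjoint_left]
    rintro σ h1 h2
    simp only [mem_shuffles, Finset.mem_map, Equiv.coe_toEmbedding, Equiv.coe_mulRight] at h1 h2
    obtain ⟨τ, h2, rfl⟩ := h2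
    have e1 := h1.1 ⟨r + p + q + 1, hn⟩ (by simp only; omega)
    rw [Equiv.Perm.mul_apply, hc, moveCycle_succ _ _ (by omega) (by omega)] at e1
    have e2 := h2.mem_block (a := ⟨r + p + q, by omega⟩) (by simp only; omega) (by simp only; omega)
    rw [e1] at e2
    simp only at e2
    omega

/-! ### Bubble decompositions of shuffles -/

lemma rankAt_le (σ : Equiv.Perm (Fin n)) (k : Fin n) : rankAt σ k ≤ k := by
  rw [rankAt, ← Fin.card_Iio k]
  exact Finset.card_le_card fun a ha => by simpa using (Finset.mem_filter.1 ha).2.1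

lemma rankAt_eq_iff (σ : Equiv.Perm (Fin n)) (k : Fin n) :
    rankAt σ k = k ↔ ∀ a < k, σ a < σ k := by
  rw [rankAt, ← Fin.card_Iio k]
  constructor
  · intro h a ha
    have hs : (Finset.univ.filter fun a : Fin n => a < k ∧ σ a < σ k) = Finset.Iio k :=
      Finset.eq_of_subset_of_card_le (fun a ha => by simpa using (Finset.mem_filter.1 ha).2.1)
        h.ge
    have : a ∈ Finset.univ.filter fun a : Fin n => a < k ∧ σ a < σ k := by
      rw [hs]
      simpa using ha
    exact (Finset.mem_filter.1 this).2.2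
  · intro h
    congr 1
    ext a
    simpa using h a

lemma bubble_eq_zero {σ : Equiv.Perm (Fin n)} {k : ℕ} (hk : k < n)
    (h : rankAt σ ⟨k, hk⟩ = k) : bubble σ k = 0 := by
  simp [bubble, hk, h]

lemma bubble_eq_rankAt {σ : Equiv.Perm (Fin n)} {k : ℕ} (hk : k < n)
    (h : rankAt σ ⟨k, hk⟩ < k) : bubble σ k = rankAt σ ⟨k, hk⟩ + 1 := by
  simp [bubble, hk, h]

lemma IsShuffle.bubble_of_lt {r p q k : ℕ} {σ : Equiv.Perm (Fin n)} (h : IsShuffle r p q σ)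
    (hk : k < r + p) : bubble σ k = 0 := by
  by_cases hn : k < n
  swap
  · simp [bubble, hn]
  refine bubble_eq_zero hn ((rankAt_eq_iff _ _).2 fun a ha => ?_)
  rw [Fin.lt_def] at ha
  simp only at ha
  by_cases hkr : k < r
  · rw [h.1 a (by omega), h.1 ⟨k, hn⟩ (by simp only; omega)]
    exact ha
  by_cases har : a.1 < r
  · have := h.mem_block (a := ⟨k, hn⟩) (by simp only; omega) (by simp only; omega)
    rw [h.1 a (by omega), Fin.lt_def]
    omega
  · exact h.2.1 a ⟨k, hn⟩ (by omega) ha (by simp only; omega)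

lemma IsShuffle.bubble_of_ge {r p q k : ℕ} {σ : Equiv.Perm (Fin n)} (h : IsShuffle r p q σ)
    (hk : r + p + q ≤ k) : bubble σ k = 0 := by
  by_cases hn : k < n
  swap
  · simp [bubble, hn]
  refine bubble_eq_zero hn ((rankAt_eq_iff _ _).2 fun a ha => ?_)
  rw [Fin.lt_def] at ha ⊢
  simp only at ha
  rw [h.1 ⟨k, hn⟩ (by simp only; omega)]
  by_cases hab : r ≤ a.1 ∧ a.1 < r + p + q
  · have := h.mem_block hab.1 hab.2
    simp only
    omega
  · rw [h.1 a (by omega)]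
    exact ha

lemma IsShuffle.rankAt_succ {r p q j : ℕ} {σ : Equiv.Perm (Fin n)} (h : IsShuffle r p q σ)
    (h1 : r + p ≤ j) (h2 : j + 1 < r + p + q) (hn : j + 1 < n)
    (hj : rankAt σ ⟨j, by omega⟩ = j) : rankAt σ ⟨j + 1, hn⟩ = j + 1 := by
  refine (rankAt_eq_iff _ ⟨j + 1, hn⟩).2 fun a ha => ?_
  have h3 := h.2.2 ⟨j, by omega⟩ ⟨j + 1, hn⟩ h1 (by simp) h2
  rw [Fin.lt_def] at ha
  simp only at ha
  by_cases haj : a.1 = j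
  · obtain rfl : a = ⟨j, Nat.lt_of_succ_lt hn⟩ := Fin.ext haj
    exact h3
  · exact ((rankAt_eq_iff _ ⟨j, by omega⟩).1 hj a (by rw [Fin.lt_def]; simp only; omega)).trans h3

lemma IsShuffle.rankAt_last_iff {r p q : ℕ} {σ : Equiv.Perm (Fin n)} (h : IsShuffle r p (q + 1) σ)
    (hn : r + p + q < n) : rankAt σ ⟨r + p + q, hn⟩ = r + p + q ↔ IsShuffle r p q σ := by
  refine ⟨fun hr => h.of_apply_last hn ?_, fun hσ => ?_⟩
  · obtain ⟨c, hc⟩ := σ.surjective ⟨r + p + q, hn⟩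
    have hc' : (σ c).1 = r + p + q := by rw [hc]
    rcases lt_trichotomy c.1 (r + p + q) with hlt | heq | hgt
    · have h1 := (rankAt_eq_iff _ _).1 hr c hlt
      have h2 := h.mem_block (a := ⟨r + p + q, hn⟩) (by simp only; omega) (by simp only; omega)
      rw [Fin.lt_def] at h1
      omega
    · nth_rewrite 2 [← hc]
      exact congrArg σ (Fin.ext heq.symm)
    · rw [h.1 c (by omega)] at hc'
      omega
  · have h1 := hσ.bubble_of_ge (le_refl (r + p + q))
    have h2 := rankAt_le σ ⟨r + p + q, hn⟩
    simp only [bubble, hn, dite_true] at h1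
    split_ifs at h1
    simp only at h2
    omega

/-- The letter sent to the end of the block is in front of no letter of the right part; the others
are merely renumbered by the cycle. -/
lemma IsShuffle.rankAt_mul_moveCycle {r p q j : ℕ} {σ : Equiv.Perm (Fin n)}
    (h : IsShuffle r p (q + 1) σ) (hn : r + p + q + 1 < n) (h1 : r + p ≤ j)
    (h2 : j < r + p + q + 1) :
    rankAt (σ * moveCycle (show r + p ≤ r + p + q + 1 by omega) hn) ⟨j + 1, by omega⟩ =
      rankAt σ ⟨j, by omega⟩ := by
  set c := moveCycle (show r + p ≤ r + p + q + 1 by omega) hn with hc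
  rw [rankAt, rankAt]
  refine Finset.card_equiv c fun a => ?_
  have hcj : c ⟨j + 1, by omega⟩ = ⟨j, by omega⟩ := moveCycle_succ _ _ h1 h2
  rw [Finset.mem_filter, Finset.mem_filter, Equiv.Perm.mul_apply, Equiv.Perm.mul_apply, hcj, hc]
  simp only [Finset.mem_univ, true_and]
  refine and_congr_left fun hlt => ?_
  obtain ⟨a, ha⟩ := a
  rcases lt_trichotomy a (r + p) with hax | rfl | hax
  · rw [moveCycle_of_lt _ _ hax]
    simp only [Fin.mk_lt_mk]
    omega
  · rw [moveCycle_left, h.1 ⟨r + p + q + 1, hn⟩ (by simp only; omega), Fin.lt_def] at hlt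
    have := h.mem_block (a := ⟨j, by omega⟩) (by simp only; omega) (by simp only; omega)
    simp only at hlt
    omega
  · by_cases hay : r + p + q + 1 < a
    · rw [moveCycle_of_gt _ _ hay]
      simp only [Fin.mk_lt_mk]
      omega
    · obtain ⟨a, rfl⟩ := Nat.exists_eq_succ_of_ne_zero (show a ≠ 0 by omega)
      rw [moveCycle_succ _ _ (by omega) (by omega)]
      simp only [Fin.mk_lt_mk]
      omega

end Shuffles

/-! ### The three-term recursion for liftings of shuffles. -/

section LiftRecursion

variable (K : Type*) [Field K] {n : ℕ}

/-- The element `σ_{i+1}` of `K[GVB_n⁺]`. -/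
noncomputable def sigAlg (n i : ℕ) : MonoidAlgebra K (GVB n) :=
  MonoidAlgebra.of K (GVB n) (sig n (i + 1))

/-- The element `σ_1 ⋯ σ_i ξ_{i+1}` of `K[GVB_n⁺]`. -/
noncomputable def fuseAlg (n i : ℕ) : MonoidAlgebra K (GVB n) :=
  MonoidAlgebra.of K (GVB n) (fuse n i)

/-- The factor of the lifting for the letter at position `k`. -/
noncomputable def bubbleFactor (d : ℕ) (σ : Equiv.Perm (Fin n)) (k : ℕ) :
    MonoidAlgebra K (GVB n) :=
  if bubble σ k = 0 then 1 else liftFactor K d σ k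

/-- The product of the factors of the lifting for the first letters. -/
noncomputable def partialLift (d : ℕ) (σ : Equiv.Perm (Fin n)) : ℕ → MonoidAlgebra K (GVB n)
  | 0 => 1
  | k + 1 => bubbleFactor K d σ k * partialLift d σ k

lemma bubble_zero (σ : Equiv.Perm (Fin n)) : bubble σ 0 = 0 := by
  simp [bubble]

lemma shuffleLift_eq_partialLift (d : ℕ) (σ : Equiv.Perm (Fin n)) :
    shuffleLift K d σ = partialLift K d σ n := by
  have key : ∀ m, (((List.range' 1 m).reverse).map (bubbleFactor K d σ)).prod =
      partialLift K d σ (m + 1) := by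
    intro m
    induction m with
    | zero => simp [partialLift, bubbleFactor, bubble_zero]
    | succ m ih =>
      rw [List.range'_1_concat, List.reverse_append, List.map_append, List.prod_append, ih,
        add_comm 1 m]
      simp only [List.reverse_singleton, List.map_cons, List.map_nil, List.prod_cons, List.prod_nil,
        mul_one]
      rfl
  cases n with
  | zero => rfl
  | succ n => exact key n

lemma liftFactor_eq {d k ρ : ℕ} {σ : Equiv.Perm (Fin n)} (h : bubble σ k = ρ + 1) :
    liftFactor K d σ k = (sigAlg K n (ρ + d) +
      (if ρ + 2 = bubble σ (k + 1) then 0 else fuseAlg K n (ρ + d))) *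
        MonoidAlgebra.of K (GVB n) (sigRun n (ρ + d + 2) (k - (ρ + 1))) := by
  rw [liftFactor, h, sigAlg, fuseAlg, fuse, show ρ + 1 + d = ρ + d + 1 by omega,
    show ρ + d + 1 - 1 = ρ + d by omega]

variable {K}

lemma sigAlg_mul_bubbleFactor {d k i : ℕ} {σ : Equiv.Perm (Fin n)} (h : k + d + 1 ≤ i)
    (hi : i + 1 < n) : sigAlg K n i * bubbleFactor K d σ k =
      bubbleFactor K d σ k * sigAlg K n i := by
  rw [bubbleFactor]
  split_ifs with hb
  · simp
  obtain ⟨ρ, hρ⟩ := Nat.exists_eq_succ_of_ne_zero hb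
  have hk : ρ < k := by
    have := hρ
    unfold bubble at this
    split_ifs at this
    omega
  have e1 : sigAlg K n i * sigAlg K n (ρ + d) = sigAlg K n (ρ + d) * sigAlg K n i := by
    simp only [sigAlg, ← map_mul, sig_comm (i := ρ + d) (j := i) (by omega) hi]
  have e2 : sigAlg K n i * fuseAlg K n (ρ + d) = fuseAlg K n (ρ + d) * sigAlg K n i := by
    simp only [sigAlg, fuseAlg, ← map_mul, sig_mul_fuse_far (m := ρ + d) (i := i) (by omega) hi]
  have e3 : sigAlg K n i * MonoidAlgebra.of K (GVB n) (sigRun n (ρ + d + 2) (k - (ρ + 1))) =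
      MonoidAlgebra.of K (GVB n) (sigRun n (ρ + d + 2) (k - (ρ + 1))) * sigAlg K n i := by
    rw [sigAlg, ← map_mul, ← map_mul, sigRun_comm fun j hj => ?_]
    rw [show ρ + d + 2 + j = ρ + d + 1 + j + 1 by omega]
    exact sig_comm (by omega) hi
  rw [liftFactor_eq K hρ, mul_assoc, ← e3, ← mul_assoc, ← mul_assoc]
  congr 1
  split_ifs
  · simpa using e1
  · rw [mul_add, add_mul, e1, e2]

lemma sigAlg_mul_partialLift {d k i : ℕ} {σ : Equiv.Perm (Fin n)} (h : k + d ≤ i)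
    (hi : i + 1 < n) : sigAlg K n i * partialLift K d σ k =
      partialLift K d σ k * sigAlg K n i := by
  induction k with
  | zero => simp [partialLift]
  | succ k ih =>
    rw [partialLift, ← mul_assoc, sigAlg_mul_bubbleFactor (by omega) hi, mul_assoc, ih (by omega),
      mul_assoc]

lemma partialLift_eq_of_bubble {d k l : ℕ} {σ : Equiv.Perm (Fin n)} (hkl : k ≤ l)
    (h : ∀ j, k ≤ j → j < l → bubble σ j = 0) : partialLift K d σ l = partialLift K d σ k := by
  induction l, hkl using Nat.le_induction with
  | base => rfl
  | succ l hl ih =>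
    rw [partialLift, ih fun j h1 h2 => h j h1 (by omega), bubbleFactor,
      if_pos (h l hl (by omega)), one_mul]

lemma IsShuffle.shuffleLift_eq {r p q d : ℕ} {σ : Equiv.Perm (Fin n)} (h : IsShuffle r p q σ)
    (hn : r + p + q ≤ n) : shuffleLift K d σ = partialLift K d σ (r + p + q) := by
  rw [shuffleLift_eq_partialLift, partialLift_eq_of_bubble hn fun j hj _ => h.bubble_of_ge hj]

variable {r p q d : ℕ} {σ : Equiv.Perm (Fin n)}

lemma IsShuffle.bubble_mul_moveCycle (h : IsShuffle r p (q + 1) σ) (hn : r + p + q + 1 < n) {j : ℕ}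
    (h1 : r + p ≤ j) (h2 : j < r + p + q + 1) :
    bubble (σ * moveCycle (show r + p ≤ r + p + q + 1 by omega) hn) (j + 1) =
      rankAt σ ⟨j, by omega⟩ + 1 := by
  have h3 := rankAt_le σ ⟨j, by omega⟩
  simp only at h3
  rw [bubble_eq_rankAt (by omega), h.rankAt_mul_moveCycle hn h1 h2]
  rw [h.rankAt_mul_moveCycle hn h1 h2]
  omega

lemma sigRun_mul_sigAlg {a l i : ℕ} (h : a + l = i + 1) :
    MonoidAlgebra.of K (GVB n) (sigRun n a (l + 1)) =
      MonoidAlgebra.of K (GVB n) (sigRun n a l) * sigAlg K n i := by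
  rw [sigRun_succ, map_mul, sigAlg, h]

lemma IsShuffle.bubbleFactor_mul_moveCycle (h : IsShuffle r p (q + 1) σ) (hn : r + p + q + 1 < n)
    {j : ℕ} (h1 : r + p ≤ j) (h2 : j < r + p + q) :
    bubbleFactor K d (σ * moveCycle (show r + p ≤ r + p + q + 1 by omega) hn) (j + 1) =
      bubbleFactor K d σ j * sigAlg K n (j + d) := by
  have hj := h.bubble_mul_moveCycle hn h1 (by omega)
  have hj' := h.bubble_mul_moveCycle hn (j := j + 1) (by omega) (by omega)
  have hle := rankAt_le σ ⟨j, by omega⟩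
  have hle' := rankAt_le σ ⟨j + 1, by omega⟩
  have hs := h.rankAt_succ h1 (by omega) (by omega)
  rw [bubbleFactor, if_neg (by omega), liftFactor_eq K hj, hj']
  generalize hρ : rankAt σ ⟨j, _⟩ = ρ at *
  generalize hρ' : rankAt σ ⟨j + 1, _⟩ = ρ' at *
  simp only at hle hle'
  by_cases hlt : ρ < j
  · have hb : bubble σ j = ρ + 1 := by
      rw [bubble_eq_rankAt (by omega) (by rwa [hρ]), hρ]
    -- If letter `j + 1` is crossed by nothing, its bubble number is `0` instead of `j + 2`; both
    -- equations then fail because `ρ < j`.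
    have hif : (ρ + 2 = ρ' + 1) ↔ (ρ + 2 = bubble σ (j + 1)) := by
      rcases Nat.lt_or_eq_of_le hle' with hlt' | rfl
      · rw [bubble_eq_rankAt (by omega) (by rwa [hρ']), hρ']
      · rw [bubble_eq_zero (by omega) hρ']
        omega
    rw [bubbleFactor, if_neg (show ¬bubble σ j = 0 by omega), liftFactor_eq K hb,
      show j + 1 - (ρ + 1) = j - (ρ + 1) + 1 by omega,
      sigRun_mul_sigAlg (i := j + d) (by omega), mul_assoc]
    simp only [hif]
  · obtain rfl : ρ = j := by omega
    -- Neither `j` nor the next letter is crossed in `σ`, so their new bubble numbers are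
    -- consecutive and the delta removes the `ξ` term.
    rw [bubbleFactor, if_pos (bubble_eq_zero (by omega) hρ), if_pos (by rw [hs rfl]), Nat.sub_self,
      sigRun_zero, map_one, add_zero, mul_one, one_mul]

/-- Behind the last letter of the block no bubble number is left to trigger the delta. Hence an
additional `ξ` term appears exactly when `σ` fixes that letter; it is the product of the two last
letters. -/
lemma IsShuffle.bubbleFactor_mul_moveCycle_last (h : IsShuffle r p (q + 1) σ)
    (hn : r + p + q + 1 < n) [Decidable (IsShuffle r p q σ)] :
    bubbleFactor K d (σ * moveCycle (show r + p ≤ r + p + q + 1 by omega) hn) (r + p + q + 1) =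
      bubbleFactor K d σ (r + p + q) * sigAlg K n (r + p + q + d) +
        if IsShuffle r p q σ then fuseAlg K n (r + p + q + d) else 0 := by
  have hj := h.bubble_mul_moveCycle hn (j := r + p + q) (by omega) (by omega)
  have hj' := (h.mul_moveCycle hn).bubble_of_ge (k := r + p + q + 1 + 1) (by omega)
  have hb' := h.bubble_of_ge (k := r + p + q + 1) (by omega)
  have hle := rankAt_le σ ⟨r + p + q, by omega⟩
  have hiff := h.rankAt_last_iff (by omega)
  rw [bubbleFactor, if_neg (by omega), liftFactor_eq K hj, hj', if_neg (by omega)]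
  generalize hρ : rankAt σ ⟨r + p + q, _⟩ = ρ at *
  simp only at hle
  by_cases hlt : ρ < r + p + q
  · have hb : bubble σ (r + p + q) = ρ + 1 := by
      rw [bubble_eq_rankAt (by omega) (by rwa [hρ]), hρ]
    rw [bubbleFactor, if_neg (by omega), liftFactor_eq K hb, hb', if_neg (by omega),
      if_neg (by rw [← hiff]; omega), show r + p + q + 1 - (ρ + 1) = r + p + q - (ρ + 1) + 1 by omega,
      sigRun_mul_sigAlg (i := r + p + q + d) (by omega), mul_assoc, add_zero]
  · obtain rfl : ρ = r + p + q := by omega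
    rw [bubbleFactor, if_pos (bubble_eq_zero (by omega) hρ), if_pos (hiff.1 rfl), Nat.sub_self,
      sigRun_zero, map_one, mul_one, one_mul]

open Classical in
/-- How the lifting of a shuffle changes if a letter is put to its right end. -/
theorem IsShuffle.shuffleLift_mul_moveCycle (h : IsShuffle r p (q + 1) σ)
    (hn : r + p + q + 1 < n) (hd : r + p + q + 1 + d < n) :
    shuffleLift K d (σ * moveCycle (show r + p ≤ r + p + q + 1 by omega) hn) =
      shuffleLift K d σ * moveRight (sigAlg K n) (r + p + d) (q + 1) +
        if IsShuffle r p q σ then fuseAlg K n (r + p + q + d) *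
          (shuffleLift K d σ * moveRight (sigAlg K n) (r + p + d) q) else 0 := by
  -- Each factor acquires one further crossing on its right. It commutes with the factors of the
  -- earlier letters, and together these crossings form the move of the left letter.
  have hp : ∀ t ≤ q, partialLift K d (σ * moveCycle (show r + p ≤ r + p + q + 1 by omega) hn)
      (r + p + t + 1) = partialLift K d σ (r + p + t) *
        moveRight (sigAlg K n) (r + p + d) t := by
    intro t ht
    induction t with
    | zero =>
      rw [partialLift_eq_of_bubble (Nat.zero_le _) fun j _ hj =>
          (h.mul_moveCycle hn).bubble_of_lt (by omega),
        partialLift_eq_of_bubble (Nat.zero_le (r + p + 0)) fun j _ hj => h.bubble_of_lt hj]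
      simp [partialLift]
    | succ t ih =>
      rw [partialLift, ← add_assoc, ih (by omega),
        h.bubbleFactor_mul_moveCycle hn (by omega) (by omega), mul_assoc,
        ← mul_assoc (sigAlg K n _), sigAlg_mul_partialLift (by omega) (by omega), partialLift,
        moveRight_succ, show r + p + d + t = r + p + t + d by omega]
      simp only [mul_assoc]
  rw [(h.mul_moveCycle hn).shuffleLift_eq (by omega), h.shuffleLift_eq (by omega),
    show r + (p + 1) + (q + 1) = r + p + q + 1 + 1 by omega, partialLift, hp q le_rfl,
    h.bubbleFactor_mul_moveCycle_last hn, add_mul, mul_assoc, ← mul_assoc (sigAlg K n _),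
    sigAlg_mul_partialLift (by omega) (by omega), ← add_assoc (r + p) q 1, partialLift,
    moveRight_succ, show r + p + d + q = r + p + q + d by omega, mul_assoc, mul_assoc]
  congr 1
  split_ifs with hs
  · rw [bubbleFactor, if_pos (hs.bubble_of_ge le_rfl), one_mul]
  · simp

end LiftRecursion

/-! ### The action of the liftings as quasi-shuffle products. -/

section Evaluation

variable {K W : Type*} [Field K] [Ring W] [Algebra K W] {br : W ⊗[K] W →ₗ[K] W ⊗[K] W}
  (h : IsBraidedAlgebra br) {n : ℕ}

lemma virtualLength_mul (a b : GVB n) :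
    virtualLength (a * b) = virtualLength a + virtualLength b := by
  simp [virtualLength]

@[simp] lemma virtualLength_one : virtualLength (1 : GVB n) = 0 := by
  simp [virtualLength]

@[simp] lemma virtualLength_sig (i : ℕ) : virtualLength (sig n i) = 0 := by
  unfold sig
  split_ifs
  · rfl
  · exact virtualLength_one

lemma virtualLength_xi {i : ℕ} (hi : 1 ≤ i ∧ i < n) : virtualLength (xi n i) = 1 := by
  rw [xi_eq hi]
  rfl

lemma virtualLength_sigRun (a l : ℕ) : virtualLength (sigRun n a l) = 0 := by
  induction l with
  | zero => simp
  | succ l ih => rw [sigRun_succ, virtualLength_mul, ih, virtualLength_sig]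

lemma virtualLength_fuse {i : ℕ} (hi : i + 1 < n) : virtualLength (fuse n i) = 1 := by
  rw [fuse, virtualLength_mul, virtualLength_sigRun, virtualLength_xi ⟨by omega, hi⟩]

/-- The linear map `K[GVB_n⁺] → End(W^{⊗n})` that sends `a` to `k(l_v(a)) a`. -/
noncomputable def weightedRep (k : ℕ → Module.End K (⨂[K]^n W)) :
    MonoidAlgebra K (GVB n) →ₗ[K] Module.End K (⨂[K]^n W) :=
  Finsupp.linearCombination K (fun a => k (virtualLength a) * repHom h n a) ∘ₗ
    (MonoidAlgebra.coeffLinearEquiv K : MonoidAlgebra K (GVB n) ≃ₗ[K] _).toLinearMap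

lemma weightedRep_apply (k : ℕ → Module.End K (⨂[K]^n W)) (x : MonoidAlgebra K (GVB n)) :
    weightedRep h k x = x.coeff.sum fun a c => c • (k (virtualLength a) * repHom h n a) := rfl

@[simp] lemma weightedRep_of (k : ℕ → Module.End K (⨂[K]^n W)) (a : GVB n) :
    weightedRep h k (MonoidAlgebra.of K (GVB n) a) = k (virtualLength a) * repHom h n a := by
  simp [weightedRep]

@[simp] lemma weightedRep_apply_one (k : ℕ → Module.End K (⨂[K]^n W)) :
    weightedRep h k 1 = k 0 := by
  rw [← map_one (MonoidAlgebra.of K (GVB n)), weightedRep_of]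
  simp

lemma weightedRep_mul_of (k : ℕ → Module.End K (⨂[K]^n W)) (x : MonoidAlgebra K (GVB n))
    (b : GVB n) : weightedRep h k (x * MonoidAlgebra.of K (GVB n) b) =
      weightedRep h (fun m => k (m + virtualLength b)) x * repHom h n b := by
  induction x using MonoidAlgebra.induction_on with
  | of a => rw [← map_mul, weightedRep_of, weightedRep_of, virtualLength_mul, map_mul, mul_assoc]
  | add x y hx hy => rw [add_mul, map_add, map_add, hx, hy, add_mul]
  | smul c x hx => rw [smul_mul_assoc, map_smul, map_smul, hx, smul_mul_assoc]

lemma weightedRep_of_mul (k : ℕ → Module.End K (⨂[K]^n W)) (x : MonoidAlgebra K (GVB n))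
    (b : GVB n) : weightedRep h k (MonoidAlgebra.of K (GVB n) b * x) =
      weightedRep h (fun m => k (virtualLength b + m) * repHom h n b) x := by
  induction x using MonoidAlgebra.induction_on with
  | of a => rw [← map_mul, weightedRep_of, weightedRep_of, virtualLength_mul, map_mul, mul_assoc]
  | add x y hx hy => rw [mul_add, map_add, map_add, hx, hy]
  | smul c x hx => rw [mul_smul_comm, map_smul, map_smul, hx]

lemma weightedRep_one (x : MonoidAlgebra K (GVB n)) :
    weightedRep h (fun _ => 1) x = rep h n x := by
  induction x using MonoidAlgebra.induction_on with
  | of a => rw [weightedRep_of, one_mul, rep_of]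
  | add x y hx hy => rw [map_add, map_add, hx, hy]
  | smul c x hx => rw [map_smul, map_smul, hx]

lemma weightedRep_sum {ι : Type*} (t : Finset ι) (k : ι → ℕ → Module.End K (⨂[K]^n W))
    (x : MonoidAlgebra K (GVB n)) : weightedRep h (fun m => ∑ i ∈ t, k i m) x =
      ∑ i ∈ t, weightedRep h (k i) x := by
  induction x using MonoidAlgebra.induction_on with
  | of a => simp only [weightedRep_of, Finset.sum_mul]
  | add x y hx hy => simp only [map_add, hx, hy, Finset.sum_add_distrib]
  | smul c x hx => simp only [map_smul, hx, Finset.smul_sum]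

lemma weightedRep_mul_moveRight (k : ℕ → Module.End K (⨂[K]^n W)) (x : MonoidAlgebra K (GVB n))
    (a l : ℕ) : weightedRep h k (x * moveRight (sigAlg K n) a l) =
      weightedRep h k x * moveRight (fun i => repHom h n (sig n (i + 1))) a l := by
  induction l generalizing x with
  | zero => simp
  | succ l ih =>
    rw [moveRight_succ, moveRight_succ, ← mul_assoc, ih, sigAlg, weightedRep_mul_of, mul_assoc]
    simp

lemma shuffleLift_one (d : ℕ) : shuffleLift K d (1 : Equiv.Perm (Fin n)) = 1 := by
  have h1 : IsShuffle 0 0 0 (1 : Equiv.Perm (Fin n)) := (isShuffle_zero (Or.inl rfl)).2 rfl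
  rw [h1.shuffleLift_eq (by omega)]
  rfl

/-- The liftings of shuffles act by the quasi-shuffle product. -/
theorem sum_weightedRep_shuffleLift {r p q d : ℕ} (k : ℕ → Module.End K (⨂[K]^n W))
    (hn : r + p + q + d ≤ n) : ∑ σ ∈ shuffles n r p q, weightedRep h k (shuffleLift K d σ) =
      shuffleSum (fun i => repHom h n (sig n (i + 1))) (fun i => repHom h n (fuse n i))
        (r + d) p q k := by
  classical
  induction p generalizing q k with
  | zero => simp [shuffles_zero, shuffleLift_one]
  | succ p ihp =>
    induction q generalizing k with
    | zero => simp [shuffles_zero, shuffleLift_one]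
    | succ q ihq =>
      have hf : (shuffles n r p (q + 1)).filter (IsShuffle r p q) = shuffles n r p q := by
        ext σ
        simp only [Finset.mem_filter, mem_shuffles, and_iff_right_iff_imp]
        exact fun hσ => hσ.mono le_rfl rfl (by omega)
      -- The `ξ` terms, restricted to the shuffles fixing the last letter, give the third term of
      -- the recursion.
      have h3 : ∑ σ ∈ shuffles n r p (q + 1), weightedRep h k (if IsShuffle r p q σ then
          fuseAlg K n (r + p + q + d) *
            (shuffleLift K d σ * moveRight (sigAlg K n) (r + p + d) q) else 0) =
          shuffleSum (fun i => repHom h n (sig n (i + 1))) (fun i => repHom h n (fuse n i))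
            (r + d + 1) p q (fun m => k (m + 1)) * (repHom h n (fuse n (r + d + p + q)) *
              moveRight (fun i => repHom h n (sig n (i + 1))) (r + d + p) q) := by
        rw [← mul_assoc, ← (fusionRel_repHom h n).shuffleSum_mul_X _ (by omega) (by omega),
          ← ihp _ (by omega)]
        simp only [apply_ite, map_zero]
        rw [← Finset.sum_filter, hf, Finset.sum_mul]
        refine Finset.sum_congr rfl fun σ _ => ?_
        rw [fuseAlg, weightedRep_of_mul, weightedRep_mul_moveRight,
          virtualLength_fuse (by omega), show r + p + q + d = r + d + p + q by omega,
          show r + p + d = r + d + p by omega]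
        simp only [add_comm 1]
      rw [sum_shuffles_succ _ (by omega), ihq _ (by omega), shuffleSum_succ, ← h3, add_assoc (shuffleSum _ _ _ _ _ _),
        ← ihp _ (by omega), Finset.sum_mul, ← Finset.sum_add_distrib]
      congr 1
      refine Finset.sum_congr rfl fun σ hσ => ?_
      have hm := (mem_shuffles.1 hσ).shuffleLift_mul_moveCycle (K := K) (d := d) (by omega)
        (by omega)
      rw [hm, map_add, weightedRep_mul_moveRight, show r + d + p = r + p + d by omega]

-- The shuffles not annihilated by `combine` are exactly those of the `p - l` and `q - m` remaining
-- letters, since these all lie in the larger set by `IsShuffle.mono`.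
open Classical in
lemma sum_weightedRep_combine {r p q : ℕ} (k : ℕ → Module.End K (⨂[K]^n W))
    (x y : MonoidAlgebra K (GVB n)) (hn : r + p + q ≤ n) :
    ∑ σ ∈ shuffles n r p q, weightedRep h k (combine K r p q σ x y) =
      weightedRep h (fun l => weightedRep h (fun m => if l < p ∧ m < q then
        shuffleSum (fun i => repHom h n (sig n (i + 1))) (fun i => repHom h n (fuse n i))
          (r + l + m) (p - l) (q - m) (fun j => k (l + m + j)) else 0) y) x := by
  have key : ∀ a b : GVB n, ∑ σ ∈ shuffles n r p q, weightedRep h k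
      (if virtualLength a < p ∧ virtualLength b < q ∧
          IsShuffle (r + virtualLength a) (p - virtualLength a) (q - virtualLength b) σ then
        shuffleLift K (virtualLength b) σ * MonoidAlgebra.of K (GVB n) (b * a) else 0) =
      (if virtualLength a < p ∧ virtualLength b < q then
        shuffleSum (fun i => repHom h n (sig n (i + 1))) (fun i => repHom h n (fuse n i))
          (r + virtualLength a + virtualLength b) (p - virtualLength a) (q - virtualLength b)
          (fun j => k (virtualLength a + virtualLength b + j)) else 0) *
            repHom h n b * repHom h n a := by
    intro a b
    by_cases hab : virtualLength a < p ∧ virtualLength b < q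
    · have hf : (shuffles n r p q).filter (IsShuffle (r + virtualLength a) (p - virtualLength a)
          (q - virtualLength b)) = shuffles n (r + virtualLength a) (p - virtualLength a)
            (q - virtualLength b) := by
        ext σ
        simp only [Finset.mem_filter, mem_shuffles, and_iff_right_iff_imp]
        exact fun hσ => hσ.mono (by omega) (by omega) (by omega)
      rw [if_pos hab, ← sum_weightedRep_shuffleLift h _ (by omega), ← hf, Finset.sum_mul,
        Finset.sum_mul, Finset.sum_filter]
      refine Finset.sum_congr rfl fun σ _ => ?_
      simp only [hab.1, hab.2, true_and]
      split_ifs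
      · rw [weightedRep_mul_of, virtualLength_mul, map_mul, mul_assoc]
        simp only [add_comm]
      · simp
    · rw [if_neg hab, zero_mul, zero_mul]
      refine Finset.sum_eq_zero fun σ _ => ?_
      rw [if_neg fun hc => hab ⟨hc.1, hc.2.1⟩, map_zero]
  simp only [weightedRep_apply h _ x, weightedRep_apply h _ y]
  simp only [combine, Finsupp.sum, map_sum, map_smul]
  rw [Finset.sum_comm]
  refine Finset.sum_congr rfl fun a _ => ?_
  rw [Finset.sum_comm, Finset.sum_mul, Finset.smul_sum]
  refine Finset.sum_congr rfl fun b _ => ?_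
  rw [← Finset.smul_sum, key, smul_mul_assoc, smul_smul]

namespace Bracketing

/-- The choices of a shuffle at every inner node of a bracketing. -/
noncomputable def shuffleLabels (n : ℕ) : (T : Bracketing) → ℕ → Finset (Labels n T)
  | leaf _, _ => {()}
  | node L R, r => shuffles n r L.size R.size ×ˢ
      (shuffleLabels n L r ×ˢ shuffleLabels n R (r + L.size))

lemma mem_shuffleLabels {T : Bracketing} {r : ℕ} {f : Labels n T} :
    f ∈ shuffleLabels n T r ↔ T.AreShuffles r f := by
  induction T generalizing r with
  | leaf c => exact iff_of_true (Finset.mem_singleton.2 rfl) trivial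
  | node L R hL hR =>
    rw [AreShuffles, ← hL, ← hR, ← mem_shuffles]
    exact Finset.mem_product.trans (and_congr_right fun _ => Finset.mem_product)

theorem sum_weightedRep_liftLabels {T : Bracketing} {r : ℕ} (k : ℕ → Module.End K (⨂[K]^n W))
    (hn : r + T.size ≤ n) : ∑ f ∈ shuffleLabels n T r, weightedRep h k (liftLabels K T r f) =
      T.quasiSum (fun i => repHom h n (sig n (i + 1))) (fun i => repHom h n (fuse n i)) r k := by
  classical
  induction T generalizing r k with
  | leaf c =>
    refine (Finset.sum_singleton _ _).trans ?_
    exact weightedRep_apply_one h k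
  | node L R hL hR =>
    simp only [size] at hn
    have h1 : ∑ f ∈ shuffleLabels n (L.node R) r, weightedRep h k (liftLabels K (L.node R) r f) =
        ∑ f ∈ shuffleLabels n L r, ∑ g ∈ shuffleLabels n R (r + L.size),
          ∑ σ ∈ shuffles n r L.size R.size, weightedRep h k (combine K r L.size R.size σ
            (liftLabels K L r f) (liftLabels K R (r + L.size) g)) := by
      refine (Finset.sum_product _ _ _).trans ?_
      rw [Finset.sum_comm]
      exact Finset.sum_product _ _ _
    rw [h1, quasiSum, quasiSum_congr (k' := fun l => ∑ g ∈ shuffleLabels n R (r + L.size),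
      weightedRep h (fun m => if l < L.size ∧ m < R.size then
        shuffleSum (fun i => repHom h n (sig n (i + 1))) (fun i => repHom h n (fuse n i))
          (r + l + m) (L.size - l) (R.size - m) (fun j => k (l + m + j)) else 0)
        (liftLabels K R (r + L.size) g)), ← hL _ (by omega)]
    · refine Finset.sum_congr rfl fun f _ => ?_
      rw [weightedRep_sum]
      refine Finset.sum_congr rfl fun g _ => ?_
      rw [sum_weightedRep_combine h k _ _ (by omega)]
    -- Each part creates fewer units than it has letters, so `l < p` and `m < q` hold automatically
    -- here.
    · intro l hl
      rw [hR _ (by omega)]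
      refine quasiSum_congr fun m hm => ?_
      rw [if_pos ⟨hl, hm⟩]

end Bracketing

end Evaluation

/-! ### Uniqueness of the decomposition into shuffles. -/

section Products

variable {n : ℕ}

lemma mem_block_of_fix {r t : ℕ} {σ : Equiv.Perm (Fin n)}
    (h : ∀ a : Fin n, a.1 < r ∨ r + t ≤ a.1 → σ a = a) (a : Fin n) :
    (r ≤ (σ a).1 ∧ (σ a).1 < r + t) ↔ (r ≤ a.1 ∧ a.1 < r + t) := by
  constructor
  · intro ha
    by_contra hc
    rw [h a (by omega)] at ha
    exact hc ha
  · intro ha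
    by_contra hc
    have := σ.injective (h (σ a) (by omega))
    rw [this] at hc
    exact hc ha

namespace IsShuffle

variable {r p q : ℕ} {σ σ' ρ : Equiv.Perm (Fin n)}

/-- Two shuffles which differ by a permutation of each of the two parts of the block are equal. -/
lemma eq_one_of_mul (hσ : IsShuffle r p q σ) (hσ' : IsShuffle r p q (σ * ρ))
    (hl : ∀ a, (r ≤ (ρ a).1 ∧ (ρ a).1 < r + p) ↔ (r ≤ a.1 ∧ a.1 < r + p))
    (hr : ∀ a, (r + p ≤ (ρ a).1 ∧ (ρ a).1 < r + p + q) ↔ (r + p ≤ a.1 ∧ a.1 < r + p + q)) :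
    ρ = 1 := by
  -- If `ρ` reversed two letters of a part, then so would `σ * ρ`, as `σ` is increasing there.
  have hlt : ∀ a b : Fin n, r ≤ a.1 → a < b → b.1 < r + p → ρ a < ρ b := by
    intro a b ha hab hb
    by_contra hc
    have h1 := (hl a).2 ⟨ha, by omega⟩
    have h2 := (hl b).2 ⟨by omega, hb⟩
    have h3 := hσ'.2.1 a b ha hab hb
    have h4 : ρ b < ρ a := lt_of_le_of_ne (not_lt.1 hc) fun h => hab.ne' (ρ.injective h)
    exact h3.asymm (hσ.2.1 _ _ h2.1 h4 h1.2)
  have hrt : ∀ a b : Fin n, r + p ≤ a.1 → a < b → b.1 < r + p + q → ρ a < ρ b := by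
    intro a b ha hab hb
    by_contra hc
    have h1 := (hr a).2 ⟨ha, by omega⟩
    have h2 := (hr b).2 ⟨by omega, hb⟩
    have h3 := hσ'.2.2 a b ha hab hb
    have h4 : ρ b < ρ a := lt_of_le_of_ne (not_lt.1 hc) fun h => hab.ne' (ρ.injective h)
    exact h3.asymm (hσ.2.2 _ _ h2.1 h4 h1.2)
  refine (isShuffle_zero (r := r) (p := p + q) (q := 0) (Or.inr rfl)).1
    ⟨fun a ha => ?_, fun a b ha hab hb => ?_, fun a b ha hab hb => by omega⟩
  · have h1 := hσ'.1 a (by omega)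
    have h2 := hl a
    have h3 := hr a
    rw [Equiv.Perm.mul_apply, hσ.1 (ρ a) (by omega)] at h1
    exact h1
  · by_cases hb' : b.1 < r + p
    · exact hlt a b ha hab hb'
    · by_cases ha' : a.1 < r + p
      · have h1 := (hl a).2 ⟨ha, ha'⟩
        have h2 := (hr b).2 ⟨by omega, by omega⟩
        rw [Fin.lt_def]
        omega
      · exact hrt a b (by omega) hab (by omega)

end IsShuffle

namespace Bracketing

lemma product_apply_of_outside {T : Bracketing} {r : ℕ} {f : Labels n T} (hf : T.AreShuffles r f)
    (a : Fin n) (ha : a.1 < r ∨ r + T.size ≤ a.1) : product T f a = a := by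
  induction T generalizing r with
  | leaf c => rfl
  | node L R hL hR =>
    simp only [size] at ha
    rw [product, Equiv.Perm.mul_apply, Equiv.Perm.mul_apply, hL hf.2.1 (by omega),
      hR hf.2.2 (by omega), hf.1.1 a (by omega)]

/-- Without a cut between them, neighbours lie in the same part at every node, where the lower
labels keep them inside this part and the label of the node is increasing. -/
lemma product_lt_product {T : Bracketing} {r : ℕ} {f : Labels n T} (hf : T.AreShuffles r f)
    {a b : Fin n} (hab : a.1 + 1 = b.1) (ha : r ≤ a.1) (hb : b.1 < r + T.size)
    (hc : b.1 ∉ T.cuts r) : product T f a < product T f b := by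
  induction T generalizing r a b with
  | leaf c =>
    change a < b
    omega
  | node L R hL hR =>
    simp only [size] at hb
    simp only [cuts, Finset.mem_union, Finset.mem_singleton, not_or] at hc
    obtain ⟨⟨hc1, hc2⟩, hc3⟩ := hc
    rw [product, Equiv.Perm.mul_apply, Equiv.Perm.mul_apply, Equiv.Perm.mul_apply,
      Equiv.Perm.mul_apply]
    by_cases hbl : b.1 < r + L.size
    · have h1 := (mem_block_of_fix (product_apply_of_outside hf.2.1) a).2 ⟨ha, by omega⟩
      have h2 := (mem_block_of_fix (product_apply_of_outside hf.2.1) b).2 ⟨by omega, hbl⟩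
      rw [product_apply_of_outside hf.2.2 _ (Or.inl h1.2),
        product_apply_of_outside hf.2.2 _ (Or.inl h2.2)]
      exact hf.1.2.1 _ _ h1.1 (hL hf.2.1 hab ha hbl hc1) h2.2
    · rw [product_apply_of_outside hf.2.1 a (by omega),
        product_apply_of_outside hf.2.1 b (by omega)]
      have h1 := (mem_block_of_fix (product_apply_of_outside hf.2.2) a).2 ⟨by omega, by omega⟩
      have h2 := (mem_block_of_fix (product_apply_of_outside hf.2.2) b).2 ⟨by omega, by omega⟩
      exact hf.1.2.2 _ _ h1.1 (hR hf.2.2 hab (by omega) (by omega) hc3) h2.2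

lemma product_mem_desLE {T : Bracketing} (hT : T.size = n) {f : Labels n T}
    (hf : T.AreShuffles 0 f) : product T f ∈ desLE n (T.cuts 0) := by
  classical
  refine Finset.mem_filter.2 ⟨Finset.mem_univ _, ?_⟩
  rintro i ⟨a, b, ha, rfl, hlt⟩
  by_contra hi
  exact hlt.asymm (product_lt_product hf ha (Nat.zero_le _) (by omega) hi)

/-- The labels below a node preserve its two parts, so `IsShuffle.eq_one_of_mul` determines the
label of the node. The products of the parts act on disjoint positions and are recovered by
restriction. -/
lemma product_injective {T : Bracketing} {r : ℕ} {f g : Labels n T} (hf : T.AreShuffles r f)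
    (hg : T.AreShuffles r g) (h : product T f = product T g) : f = g := by
  induction T generalizing r with
  | leaf c => rfl
  | node L R hL hR =>
    obtain ⟨σ, f1, f2⟩ := f
    obtain ⟨τ, g1, g2⟩ := g
    obtain ⟨hσ, hf1, hf2⟩ := hf
    obtain ⟨hτ, hg1, hg2⟩ := hg
    simp only at hσ hf1 hf2 hτ hg1 hg2
    simp only [product] at h
    have hl : ∀ {l : Labels n L} {m : Labels n R}, L.AreShuffles r l →
        R.AreShuffles (r + L.size) m → ∀ a, (r ≤ ((product R m * product L l) a).1 ∧
          ((product R m * product L l) a).1 < r + L.size) ↔ (r ≤ a.1 ∧ a.1 < r + L.size) := by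
      intro l m hl hm a
      have h1 := mem_block_of_fix (product_apply_of_outside hl) a
      have h2 := mem_block_of_fix (product_apply_of_outside hm) (product L l a)
      have h3 := product_apply_of_outside hm (product L l a)
      rw [Equiv.Perm.mul_apply, ← h1]
      by_cases hc : r + L.size ≤ (product L l a).1 ∧ (product L l a).1 < r + L.size + R.size
      · have := h2.2 hc
        omega
      · rw [h3 (by omega)]
    have hr : ∀ {l : Labels n L} {m : Labels n R}, L.AreShuffles r l →
        R.AreShuffles (r + L.size) m → ∀ a, (r + L.size ≤ ((product R m * product L l) a).1 ∧
          ((product R m * product L l) a).1 < r + L.size + R.size) ↔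
            (r + L.size ≤ a.1 ∧ a.1 < r + L.size + R.size) := by
      intro l m hl hm a
      have h1 := mem_block_of_fix (product_apply_of_outside hl) a
      have h2 := product_apply_of_outside hl a
      rw [Equiv.Perm.mul_apply, mem_block_of_fix (product_apply_of_outside hm)]
      by_cases hc : r ≤ a.1 ∧ a.1 < r + L.size
      · have := h1.2 hc
        omega
      · rw [h2 (by omega)]
    set P := product R f2 * product L f1 with hP
    set Q := product R g2 * product L g1 with hQ
    have hστ : τ = σ * (P * Q⁻¹) := by
      rw [← mul_assoc, h, mul_inv_cancel_right]
    have hPQ : P * Q⁻¹ = 1 := by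
      refine hσ.eq_one_of_mul (hστ ▸ hτ) (fun a => ?_) fun a => ?_
      · rw [Equiv.Perm.mul_apply, hl hf1 hf2, ← hl hg1 hg2 (Q⁻¹ a), ← hQ, ← Equiv.Perm.mul_apply Q,
          mul_inv_cancel, Equiv.Perm.one_apply]
      · rw [Equiv.Perm.mul_apply, hr hf1 hf2, ← hr hg1 hg2 (Q⁻¹ a), ← hQ, ← Equiv.Perm.mul_apply Q,
          mul_inv_cancel, Equiv.Perm.one_apply]
    have hPQ' : P = Q := mul_inv_eq_one.1 hPQ
    have hL' : product L f1 = product L g1 := by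
      ext a
      by_cases ha : r ≤ a.1 ∧ a.1 < r + L.size
      · have h1 := (mem_block_of_fix (product_apply_of_outside hf1) a).2 ha
        have h2 := (mem_block_of_fix (product_apply_of_outside hg1) a).2 ha
        have h3 := Equiv.congr_fun hPQ' a
        rw [hP, hQ, Equiv.Perm.mul_apply, Equiv.Perm.mul_apply,
          product_apply_of_outside hf2 _ (Or.inl h1.2),
          product_apply_of_outside hg2 _ (Or.inl h2.2)] at h3
        rw [h3]
      · rw [product_apply_of_outside hf1 _ (by omega), product_apply_of_outside hg1 _ (by omega)]
    have hR' : product R f2 = product R g2 := by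
      rw [hP, hQ, hL'] at hPQ'
      exact mul_right_cancel hPQ'
    obtain rfl := hL hf1 hg1 hL'
    obtain rfl := hR hf2 hg2 hR'
    rw [hPQ, mul_one] at hστ
    rw [hστ]

lemma lift_product {K : Type*} [Field K] {T : Bracketing} {f : Labels n T}
    (hf : T.AreShuffles 0 f) : T.lift K (product T f) = liftLabels K T 0 f := by
  have hex : ∃ g : Labels n T, T.AreShuffles 0 g ∧ T.product g = T.product f := ⟨f, hf, rfl⟩
  rw [lift, dif_pos hex, product_injective hex.choose_spec.1 hf hex.choose_spec.2]

/-- It suffices that products of labels lie in `desLE`: `lift` vanishes on permutations without a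
decomposition, so surjectivity plays no role. -/
lemma linearLift_descentSum (K : Type*) [Field K] {T : Bracketing} (hT : T.size = n) :
    T.linearLift K n (descentSum K n (T.cuts 0)) =
      ∑ f ∈ shuffleLabels n T 0, liftLabels K T 0 f := by
  classical
  have h1 : T.linearLift K n (descentSum K n (T.cuts 0)) =
      ∑ σ ∈ desLE n (T.cuts 0), T.lift K σ := by
    simp [linearLift, descentSum]
  have h2 : (shuffleLabels n T 0).image T.product ⊆ desLE n (T.cuts 0) := by
    intro σ hσ
    obtain ⟨f, hf, rfl⟩ := Finset.mem_image.1 hσ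
    exact product_mem_desLE hT (mem_shuffleLabels.1 hf)
  rw [h1, ← Finset.sum_subset h2, Finset.sum_image]
  · exact Finset.sum_congr rfl fun f hf => lift_product (mem_shuffleLabels.1 hf)
  · exact fun f hf g hg => product_injective (mem_shuffleLabels.1 hf) (mem_shuffleLabels.1 hg)
  · intro σ _ hσ
    rw [lift, dif_neg]
    rintro ⟨f, hf, rfl⟩
    exact hσ (Finset.mem_image_of_mem _ (mem_shuffleLabels.2 hf))

end Bracketing

end Products

end QuasiShuffle

/-! ### The comparison of two bracketings. -/

theorem corollary4p3 {K W : Type*} [Field K] [Ring W] [Algebra K W]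
    (br : TensorProduct K W W →ₗ[K] TensorProduct K W W)
    (hbr : QuasiShuffle.IsBraidedAlgebra br)
    (n : ℕ) (I : Finset ℕ) (T T' : QuasiShuffle.Bracketing)
    (hT : T.size = n) (hI : T.cuts 0 = I) (hT' : T'.size = n) (hI' : T'.cuts 0 = I) :
    QuasiShuffle.rep hbr n (T.linearLift K n (QuasiShuffle.descentSum K n I)) =
      QuasiShuffle.rep hbr n (T'.linearLift K n (QuasiShuffle.descentSum K n I)) := by
  have key : ∀ S : QuasiShuffle.Bracketing, S.size = n → S.cuts 0 = I →
      QuasiShuffle.rep hbr n (S.linearLift K n (QuasiShuffle.descentSum K n I)) =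
        S.quasiSum (fun i => QuasiShuffle.repHom hbr n (QuasiShuffle.sig n (i + 1)))
          (fun i => QuasiShuffle.repHom hbr n (QuasiShuffle.fuse n i)) 0 fun _ => 1 := by
    rintro S hS rfl
    -- With the constant continuation `1` the weighted action is the representation itself.
    rw [QuasiShuffle.Bracketing.linearLift_descentSum K hS, ← QuasiShuffle.weightedRep_one,
      map_sum, QuasiShuffle.Bracketing.sum_weightedRep_liftLabels hbr _ (by omega)]
  rw [key T hT hI, key T' hT' hI']
  exact (QuasiShuffle.fusionRel_repHom hbr n).quasiSum_eq_of_cuts_eq (hT.trans hT'.symm)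
    (hI.trans hI'.symm) _ (by omega)
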